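/- All knots are tame knots in $S^3$. For a knot $K$ let $E(K)$ be its exterior (the complement of an open tubular neighbourhood) and $G(K)=\pi_1(E(K))$. A \emph{meridian} of $G(K)$ is an element represented by a loop freely homotopic to a meridional simple closed curve on $\partial E(K)$ (with either orientation), i.e. to the boundary of a meridian disc of the tubular neighbourhood. The \emph{$\pi$-orbifold group} is $G^{\mathrm{orb}}(K)=G(K)/N$, where $N$ is the subgroup normally generated by the squares of all meridians. The \emph{meridional complexity} of $\gamma\in G(K)$ is the least number of distinct meridians such that $\gamma$ is a product of powers (with integer exponents) of these meridians. A knot $K_1$ \emph{dominates} $K_2$ if there is an epimorphism $G(K_1)\to G(K_2)$; it \emph{$k$-dominates} $K_2$ if there is an epimorphism $G(K_1)\to G(K_2)$ sending a meridian to an element of meridional complexity at most $k$; it \emph{$\pi$-dominates} $K_2$ if there is an epimorphism $G^{\mathrm{orb}}(K_1)\to G^{\mathrm{orb}}(K_2)$. The bridge number of $K$ is the least $n$ such that $S^3$ is the union of two balls that meet exactly in their common boundary sphere and each meet $K$ in a trivial $n$-string tangle; $K$ is a \emph{2-bridge knot} if its bridge number is $2$. A homomorphism $\varphi\colon G(K_1)\to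 G(K_2)$ \emph{induces} $\psi\colon G^{\mathrm{orb}}(K_1)\to G^{\mathrm{orb}}(K_2)$ if $\psi$ composed with the projection $G(K_1)\to G^{\mathrm{orb}}(K_1)$ equals $\varphi$ followed by the projection $G(K_2)\to G^{\mathrm{orb}}(K_2)$. Let $K_1,K_2$ be knots. (1) Let $\varphi\colon G(K_1)\to G(K_2)$ be an epimorphism. If the image under $\varphi$ of a meridian of $G(K_1)$ has meridional complexity at most $2$, then $\varphi$ induces an epimorphism $G^{\mathrm{orb}}(K_1)\to G^{\mathrm{orb}}(K_2)$. (2) If $K_1$ $2$-dominates $K_2$, then $K_1$ $\pi$-dominates $K_2$. (3) If $K_2$ is a $2$-bridge knot, then every epimorphism $G(K_1)\to G(K_2)$ induces an epimorphism $G^{\mathrm{orb}}(K_1)\to G^{\mathrm{orb}}(K_2)$. In particular, if $K_1$ dominates $K_2$, then $K_1$ $\pi$-dominates $K_2$. -/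

import Mathlib

open Metric

noncomputable section

/-- The 3-sphere. -/
abbrev Sphere3 : Type := sphere (0 : EuclideanSpace ℝ (Fin 4)) 1

/-- A (tame) knot in the 3-sphere, given together with a tubular neighbourhood: an open embedding
of `S¹ × ℝ²` (with `ℝ² = ℂ`). The knot itself is the image of `S¹ × {0}`. Tameness of a knot means
precisely that such a neighbourhood exists, and every choice of it is allowed here. -/
structure TameKnot where
  tube : Circle × ℂ → Sphere3
  isOpenEmbedding_tube : Topology.IsOpenEmbedding tube

namespace TameKnot

/-- The underlying knot, as a subset of the 3-sphere. -/
def core (K : TameKnot) : Set Sphere3 := K.tube '' {p | p.2 = 0}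

/-- The exterior `E(K)`: the complement of the open solid torus `S¹ × {|w| < 1}` around the knot. -/
def exterior (K : TameKnot) : Set Sphere3 := (K.tube '' {p | ‖p.2‖ < 1})ᶜ

lemma tube_mem_exterior (K : TameKnot) (z w : Circle) : K.tube (z, (w : ℂ)) ∈ K.exterior := by
  rintro ⟨p, hp, h⟩
  have := K.isOpenEmbedding_tube.injective h
  subst this
  have hw : ‖(w : ℂ)‖ = 1 := Circle.norm_coe w
  exact absurd hp (by simp [hw])

/-- The point with coordinates `(z, w)` of the torus `∂E(K)`. -/
def bdryPoint (K : TameKnot) (z w : Circle) : K.exterior :=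
  ⟨K.tube (z, (w : ℂ)), K.tube_mem_exterior z w⟩

lemma continuous_bdryPoint (K : TameKnot) : Continuous fun p : Circle × Circle =>
    K.bdryPoint p.1 p.2 :=
  Continuous.subtype_mk
    (K.isOpenEmbedding_tube.continuous.comp (by fun_prop)) _

/-- The base point used for the knot group; it lies on `∂E(K)`. -/
def basePoint (K : TameKnot) : K.exterior := K.bdryPoint 1 1

/-- The knot group `G(K)`, the fundamental group of the exterior. -/
abbrev Group (K : TameKnot) : Type := FundamentalGroup K.exterior K.basePoint

/-- The meridional simple closed curve `{z} × {|w| = 1}` on `∂E(K)`: the boundary of the meridian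
disc `{z} × {|w| ≤ 1}` of the tubular neighbourhood, traversed once from `(z, 1)`. -/
def meridianLoop (K : TameKnot) (z : Circle) : Path (K.bdryPoint z 1) (K.bdryPoint z 1) where
  toFun t := K.bdryPoint z (Circle.exp (2 * Real.pi * (t : ℝ)))
  continuous_toFun :=
    K.continuous_bdryPoint.comp (f := fun t : unitInterval =>
      (z, Circle.exp (2 * Real.pi * (t : ℝ)))) (by fun_prop)
  source' := by simp
  target' := by simp

/-- An element of `G(K)` is a meridian if it is represented by a loop that is freely homotopic to a
meridional simple closed curve on `∂E(K)`, with either orientation; that is, by a loop which runs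
along a path `c` to `∂E(K)`, once around a meridional curve, and back along `c`. -/
def IsMeridian (K : TameKnot) (g : K.Group) : Prop :=
  ∃ (z : Circle) (c : Path K.basePoint (K.bdryPoint z 1)),
    g = FundamentalGroup.fromPath ⟦(c.trans (K.meridianLoop z)).trans c.symm⟧ ∨
    g = FundamentalGroup.fromPath ⟦(c.trans (K.meridianLoop z).symm).trans c.symm⟧

/-- The subgroup normally generated by the squares of all meridians. -/
def squaresSubgroup (K : TameKnot) : Subgroup K.Group :=
  Subgroup.normalClosure {g | ∃ m, K.IsMeridian m ∧ g = m ^ 2}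

instance (K : TameKnot) : K.squaresSubgroup.Normal := Subgroup.normalClosure_normal

/-- The π-orbifold group `G^orb(K)`. -/
abbrev OrbGroup (K : TameKnot) : Type := K.Group ⧸ K.squaresSubgroup

/-- The meridional complexity of `g`: the least number of distinct meridians such that `g` is a
product of powers (with integer exponents) of these meridians. -/
def meridionalComplexity (K : TameKnot) (g : K.Group) : ℕ∞ :=
  ⨅ (S : Finset K.Group) (_ : (∀ m ∈ S, K.IsMeridian m) ∧ g ∈ Subgroup.closure (S : Set K.Group)),
    (S.card : ℕ∞)

/-- `K₁` dominates `K₂`. -/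
def Dominates (K₁ K₂ : TameKnot) : Prop :=
  ∃ φ : K₁.Group →* K₂.Group, Function.Surjective φ

/-- `K₁` `k`-dominates `K₂`. -/
def KDominates (k : ℕ) (K₁ K₂ : TameKnot) : Prop :=
  ∃ φ : K₁.Group →* K₂.Group, Function.Surjective φ ∧
    ∃ μ, K₁.IsMeridian μ ∧ K₂.meridionalComplexity (φ μ) ≤ k

/-- `K₁` π-dominates `K₂`. -/
def PiDominates (K₁ K₂ : TameKnot) : Prop :=
  ∃ ψ : K₁.OrbGroup →* K₂.OrbGroup, Function.Surjective ψ

/-- The homomorphism `φ` of knot groups induces an epimorphism of π-orbifold groups. -/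
def InducesOrbEpi {K₁ K₂ : TameKnot} (φ : K₁.Group →* K₂.Group) : Prop :=
  ∃ ψ : K₁.OrbGroup →* K₂.OrbGroup, Function.Surjective ψ ∧
    ∀ g : K₁.Group, ψ (g : K₁.OrbGroup) = ((φ g : K₂.Group) : K₂.OrbGroup)

end TameKnot

/-- The closed cylinder `D² × [0, 1]`, the model of the 3-ball. -/
abbrev Cylinder : Type := closedBall (0 : ℂ) 1 × unitInterval

/-- The boundary 2-sphere of the cylinder. -/
def Cylinder.bdry : Set Cylinder := {p | ‖(p.1 : ℂ)‖ = 1 ∨ p.2 = 0 ∨ p.2 = 1}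

/-- `B` is a closed 3-ball with boundary sphere `S` that meets `T` in a trivial `n`-string tangle:
the pair `(B, B ∩ T)` is homeomorphic to `(D² × [0, 1], Q × [0, 1])`, where `Q` consists of `n`
interior points of the disc. -/
def IsTrivialTangle (B S T : Set Sphere3) (n : ℕ) : Prop :=
  ∃ e : Cylinder → Sphere3, Topology.IsEmbedding e ∧ Set.range e = B ∧ e '' Cylinder.bdry = S ∧
    ∃ Q : Finset ℂ, Q.card = n ∧ (∀ q ∈ Q, ‖q‖ < 1) ∧ ∀ p : Cylinder, e p ∈ T ↔ (p.1 : ℂ) ∈ Q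

namespace TameKnot

/-- `K` has an `n`-bridge presentation: the 3-sphere is the union of two 3-balls that meet exactly
in their common boundary sphere, and `K` meets each ball in a trivial `n`-string tangle. -/
def HasBridgePresentation (K : TameKnot) (n : ℕ) : Prop :=
  ∃ B₁ B₂ : Set Sphere3, B₁ ∪ B₂ = Set.univ ∧
    IsTrivialTangle B₁ (B₁ ∩ B₂) K.core n ∧ IsTrivialTangle B₂ (B₁ ∩ B₂) K.core n

/-- The bridge number `b(K)`. -/
def bridgeNumber (K : TameKnot) : ℕ∞ := ⨅ (n : ℕ) (_ : K.HasBridgePresentation n), (n : ℕ∞)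

/-- `K` is a 2-bridge knot. -/
def IsTwoBridge (K : TameKnot) : Prop := K.bridgeNumber = 2

end TameKnot

end

/-! ### Homotopy classes of paths, and the circle. -/

open unitInterval Set Topology

/-! Suppose `φ` is onto and `φ μ` lies in the subgroup generated by two meridians `m₁`, `m₂`. In the
orbifold group these become involutions `a`, `b`, so the image of `φ μ` is a rotation `(ab)^k` or a
reflection `(ab)^k a`, and a reflection has trivial square. The mod 2 linking number `χ`, which is
`-1` on every meridian, excludes rotations: otherwise `χ ∘ φ` would kill `μ`, hence all meridians of
the source, hence everything, although `φ` is onto and `χ m₁ = -1`. As meridians are conjugate up to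
inversion, `φ` then sends the squares of all of them into the squares subgroup and descends
(`inducesOrbEpi_of_mem_closure`).

Three topological facts carry this.

`exists_linking_character`: the angular coordinate around the knot is the clutching function of a
circle bundle over a box in `ℝ³`. A trivialization yields a map from the exterior to the circle that
has degree one on a meridian.

`eq_one_of_meridian`: a character of the knot group is the holonomy of a local system on the
exterior. If it is trivial on meridians, the local system extends over the solid torus; it is then
trivial over a box, and so is the character.

`HasBridgePresentation.exists_closure_eq_top`: each tangle complement is a twice punctured disc
times an interval. Gluing on the second one adds no generators to the fundamental group of the
first, which is generated by loops around the two punctures. This gives the 2-bridge case, because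
then every element lies in the subgroup generated by two meridians. -/

/-- Paths factoring through a convex set with the same endpoints are homotopic. -/
theorem Path.Homotopic.mk_eq_of_convex {V X : Type*} [AddCommGroup V] [Module ℝ V]
    [TopologicalSpace V] [IsTopologicalAddGroup V] [ContinuousSMul ℝ V] [TopologicalSpace X]
    {C : Set V} (hC : Convex ℝ C) {f : V → X} (hf : ContinuousOn f C) {a b : X}
    (p q : Path a b) (p' q' : I → V) (hp' : Continuous p') (hq' : Continuous q')
    (hpC : ∀ t, p' t ∈ C) (hqC : ∀ t, q' t ∈ C) (h0 : p' 0 = q' 0) (h1 : p' 1 = q' 1)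
    (hp : ∀ t, p t = f (p' t)) (hq : ∀ t, q t = f (q' t)) :
    Path.Homotopic.Quotient.mk p = Path.Homotopic.Quotient.mk q := by
  rw [Path.Homotopic.Quotient.eq]
  have hmem (x : I × I) : (1 - (x.1 : ℝ)) • p' x.2 + (x.1 : ℝ) • q' x.2 ∈ C :=
    hC (hpC _) (hqC _) (by have := x.1.2.2; linarith) x.1.2.1 (by ring)
  refine ⟨⟨⟨⟨fun x => f ((1 - (x.1 : ℝ)) • p' x.2 + (x.1 : ℝ) • q' x.2), ?_⟩, ?_, ?_⟩, ?_⟩⟩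
  · exact hf.comp_continuous (by fun_prop) hmem
  · intro t; simp [hp]
  · intro t; simp [hq]
  · rintro s t (rfl | rfl)
    · simp only [ContinuousMap.coe_mk, Path.coe_toContinuousMap, hp, ← h0]
      rw [← add_smul]; simp
    · simp only [ContinuousMap.coe_mk, Path.coe_toContinuousMap, hp, ← h1]
      rw [← add_smul]; simp

namespace Path.Homotopic.Quotient

/-- A property of homotopy classes of paths that is stable under concatenation holds for all
classes if it holds for short paths. -/
theorem forall_of_local {X : Type*} [TopologicalSpace X]
    (P : ∀ x y : X, Path.Homotopic.Quotient x y → Prop)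
    (htrans : ∀ x y z (p : Path.Homotopic.Quotient x y) (q : Path.Homotopic.Quotient y z),
      P x y p → P y z q → P x z (p.trans q))
    (hloc : ∀ x, ∃ N ∈ 𝓝 x, ∀ y z (p : Path y z), (∀ t, p t ∈ N) → P y z (mk p))
    {x y : X} (p : Path.Homotopic.Quotient x y) : P x y p := by
  induction p using Path.Homotopic.Quotient.ind with
  | mk p =>
  -- Subdividing produces a path from `p 0` to `p 1`, whose endpoints equal `x` and `y` only
  -- propositionally.
  have P_cast {x' y' x y : X} (hx : x = x') (hy : y = y') (p : Path x y) :
      P x' y' (mk (p.cast hx.symm hy.symm)) → P x y (mk p) := by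
    subst hx hy
    exact id
  choose N hN hP using hloc
  obtain ⟨t, ht0, htm, ⟨n, hn⟩, ht⟩ := exists_monotone_Icc_subset_open_cover_unitInterval
    (c := fun x : X => p ⁻¹' (interior (N x))) (fun x => isOpen_interior.preimage p.continuous)
    (fun s _ => mem_iUnion.2 ⟨p s, mem_interior_iff_mem_nhds.2 (hN _)⟩)
  have key (s s' : I) (i : X) (h : s ≤ s') (hs : Icc s s' ⊆ p ⁻¹' (interior (N i))) :
      P _ _ (mk (p.subpath s s')) := by
    refine hP i _ _ _ fun u => interior_subset ?_
    have : p.subpath s s' u ∈ range (p.subpath s s') := mem_range_self u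
    rw [Path.range_subpath_of_le p s s' h] at this
    obtain ⟨v, hv, e⟩ := this
    rw [← e]; exact hs hv
  have hind : ∀ k, P _ _ (mk (p.subpath 0 (t k))) := by
    intro k
    induction k with
    | zero =>
      obtain ⟨i, hi⟩ := ht 0
      refine key _ _ i (by simp) (fun v hv => ?_)
      have : v = t 0 := le_antisymm hv.2 (by rw [ht0]; exact hv.1)
      rw [this]; exact hi ⟨le_rfl, htm (by omega)⟩
    | succ k ih =>
      obtain ⟨i, hi⟩ := ht k
      have h2 := key (t k) (t (k + 1)) i (htm (by omega)) hi
      have := htrans _ _ _ _ _ ih h2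
      rwa [← mk_trans, eq.2 ⟨Path.Homotopy.subpathTransSubpath p 0 (t k) (t (k+1))⟩] at this
  have h1 := hind n
  rw [hn n le_rfl, Path.subpath_zero_one] at h1
  have e0 := p.source
  have e1 := p.target
  exact P_cast e0.symm e1.symm p h1

end Path.Homotopic.Quotient

/-- The loop running once around the circle. -/
noncomputable def Circle.stdLoop : Path (1 : Circle) 1 where
  toFun t := Circle.exp (2 * Real.pi * (t : ℝ))
  source' := by simp
  target' := by simp

theorem Circle.zpowers_stdLoop (g : FundamentalGroup Circle 1) :
    g ∈ Subgroup.zpowers (FundamentalGroup.fromPath (.mk Circle.stdLoop)) := by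
  let h := Circle.isAddQuotientCoveringMap_exp
  let e : Circle.exp ⁻¹' {1} := ⟨0, by simp⟩
  -- The lift of the loop that starts at `0` ends at `2π`, so the loop maps to a generator of the
  -- deck group `2πℤ`; the map to the deck group is injective.
  have hm : (h.isCoveringMap.monodromy (.mk Circle.stdLoop) e).1 = 2 * Real.pi := by
    have := h.isCoveringMap.monodromy_eq_of_map_eq (γ := .mk Circle.stdLoop) (ex := e)
      (ey := ⟨2 * Real.pi, by simp⟩)
      (.mk ⟨⟨fun t => 2 * Real.pi * (t : ℝ), by fun_prop⟩, by simp [e], by simp⟩) rfl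
    rw [this]
  have hs : h.fundamentalGroupToMulOpposite e (FundamentalGroup.fromPath (.mk Circle.stdLoop)) =
      MulOpposite.op (Multiplicative.ofAdd ⟨2 * Real.pi, AddSubgroup.mem_zmultiples _⟩) := by
    rw [h.fundamentalGroupToMulOpposite_apply_eq_Iff]
    refine Eq.trans ?_ hm.symm
    change 2 * Real.pi + 0 = _
    simp
  obtain ⟨n, hn⟩ := (h.fundamentalGroupToMulOpposite e g).unop.toAdd.2
  refine ⟨n, h.fundamentalGroupToMulOpposite_injective e ?_⟩
  simp only [map_zpow, hs]
  apply MulOpposite.unop_injective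
  apply Multiplicative.toAdd.injective
  apply Subtype.ext
  simpa using hn

/-- The two ways around a square are homotopic. -/
theorem Path.Homotopic.square {X : Type*} [TopologicalSpace X] (H : C(I × I, X)) {a b c d : X}
    (bot : Path a b) (right : Path b d) (left : Path a c) (top : Path c d)
    (hb : ∀ t, bot t = H (t, 0)) (hr : ∀ t, right t = H (1, t)) (hl : ∀ t, left t = H (0, t))
    (ht : ∀ t, top t = H (t, 1)) :
    (Quotient.mk bot).trans (.mk right) = (Quotient.mk left).trans (.mk top) := by
  let f : C(I, X) := ⟨fun t => H (t, 0), by fun_prop⟩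
  let g : C(I, X) := ⟨fun t => H (t, 1), by fun_prop⟩
  let F : f.Homotopy g := ⟨⟨fun x => H (x.2, x.1), by fun_prop⟩, fun _ => rfl, fun _ => rfl⟩
  obtain rfl : a = f 0 := by rw [← bot.source, hb]; rfl
  obtain rfl : b = f 1 := by rw [← bot.target, hb]; rfl
  obtain rfl : c = g 0 := by rw [← left.target, hl]; rfl
  obtain rfl : d = g 1 := by rw [← right.target, hr]; rfl
  have h1 : bot = (Path.mk (ContinuousMap.id I) rfl rfl).map (map_continuous f) := by
    ext t; exact hb t
  have h2 : right = F.evalAt 1 := by ext t; exact hr t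
  have h3 : left = F.evalAt 0 := by ext t; exact hl t
  have h4 : top = (Path.mk (ContinuousMap.id I) rfl rfl).map (map_continuous g) := by
    ext t; exact ht t
  rw [h1, h2, h3, h4]
  exact Path.Homotopic.Quotient.eq.2 (Path.Homotopic.map_trans_evalAt F _)

/-! ### Change of base point and homotopic maps. -/

namespace FundamentalGroup

variable {X Y : Type*} [TopologicalSpace X] [TopologicalSpace Y] {x y z : X}

/-- Transport of loops along a path. -/
noncomputable def conjPath (c : Path.Homotopic.Quotient x y) : FundamentalGroup X y →* FundamentalGroup X x where
  toFun g := (c.trans g.toPath).trans c.symm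
  map_one' := by
    change (c.trans (.refl y)).trans c.symm = .refl x
    simp
  map_mul' g h := by
    change (c.trans (h.toPath.trans g.toPath)).trans c.symm =
      ((c.trans h.toPath).trans c.symm).trans ((c.trans g.toPath).trans c.symm)
    simp only [Path.Homotopic.Quotient.trans_assoc]
    rw [← Path.Homotopic.Quotient.trans_assoc c.symm c]
    simp

/-- In `FundamentalGroup` the product `g * h` runs along `h` before `g`. This is why transport along
a loop `c` is conjugation in the form `c⁻¹ * g * c`. -/
theorem conjPath_apply (c : Path.Homotopic.Quotient x y) (g : FundamentalGroup X y) :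
    conjPath c g = (c.trans g.toPath).trans c.symm := rfl

theorem conjPath_conjPath (c : Path.Homotopic.Quotient x y) (d : Path.Homotopic.Quotient y z)
    (g : FundamentalGroup X z) : conjPath c (conjPath d g) = conjPath (c.trans d) g := by
  have : (c.trans d).symm = d.symm.trans c.symm := by
    induction c; induction d
    simp only [← Path.Homotopic.Quotient.mk_trans, ← Path.Homotopic.Quotient.mk_symm,
      Path.trans_symm]
  simp only [conjPath_apply, this, Path.Homotopic.Quotient.trans_assoc]

theorem conjPath_refl (g : FundamentalGroup X x) : conjPath (.refl x) g = g := by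
  have : (Path.Homotopic.Quotient.refl x).symm = .refl x := by
    simp only [← Path.Homotopic.Quotient.mk_refl, ← Path.Homotopic.Quotient.mk_symm,
      Path.refl_symm]
  simp only [conjPath_apply, this, Path.Homotopic.Quotient.refl_trans,
    Path.Homotopic.Quotient.trans_refl]

theorem conjPath_surjective (c : Path.Homotopic.Quotient x y) :
    Function.Surjective (conjPath c) := fun g =>
  ⟨conjPath c.symm g, by simp [conjPath_conjPath, conjPath_refl]⟩

/-- Transport along a loop is conjugation. -/
theorem conjPath_self (c g : FundamentalGroup X x) :
    conjPath (toPath c) g = c⁻¹ * g * c := by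
  rw [conjPath_apply, mul_def, mul_def, Path.Homotopic.Quotient.trans_assoc]
  rfl

theorem map_conjPath (f : C(X, Y)) (c : Path.Homotopic.Quotient x y) (g : FundamentalGroup X y) :
    map f x (conjPath c g) = conjPath (c.map f) (map f y g) := by
  induction c
  induction g using Path.Homotopic.Quotient.ind
  change Path.Homotopic.Quotient.mk (Path.map _ _) = Path.Homotopic.Quotient.mk _
  rw [Path.map_trans, Path.map_trans, Path.map_symm]

end FundamentalGroup

namespace ContinuousMap.Homotopy

/-- Homotopic maps act on loops by conjugate homomorphisms. -/
theorem map_eq_conjPath {X Y : Type*} [TopologicalSpace X] [TopologicalSpace Y] {f g : C(X, Y)}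
    (F : f.Homotopy g) {x : X} (γ : FundamentalGroup X x) :
    FundamentalGroup.map f x γ =
      FundamentalGroup.conjPath (.mk (F.evalAt x)) (FundamentalGroup.map g x γ) := by
  induction γ using Path.Homotopic.Quotient.ind with
  | mk γ =>
  have h := Path.Homotopic.Quotient.eq.2 (Path.Homotopic.map_trans_evalAt F γ)
  rw [Path.Homotopic.Quotient.mk_trans, Path.Homotopic.Quotient.mk_trans] at h
  rw [FundamentalGroup.conjPath_apply]
  change Path.Homotopic.Quotient.mk (Path.map _ _) = _
  refine Eq.trans ?_ (congrArg (fun q => Path.Homotopic.Quotient.trans q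
    (Path.Homotopic.Quotient.mk (F.evalAt x)).symm) h)
  simp [Path.Homotopic.Quotient.trans_assoc]

end ContinuousMap.Homotopy

theorem FundamentalGroup.map_comp_apply {X Y Z : Type*} [TopologicalSpace X] [TopologicalSpace Y]
    [TopologicalSpace Z] (g : C(Y, Z)) (f : C(X, Y)) (x : X) (γ : FundamentalGroup X x) :
    FundamentalGroup.map (g.comp f) x γ = FundamentalGroup.map g (f x) (FundamentalGroup.map f x γ) :=
  Path.Homotopic.Quotient.map_comp

/-- The direction of a complex number, with junk value at zero. -/
noncomputable def Complex.dir (w : ℂ) : Circle :=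
  if h : w = 0 then 1 else ⟨w / ‖w‖, by simp [Submonoid.unitSphere, h]⟩

theorem Complex.coe_dir {w : ℂ} (h : w ≠ 0) : (w.dir : ℂ) = w / ‖w‖ := by
  simp [Complex.dir, h]

theorem Circle.isEmbedding_coe : IsEmbedding (fun u : Circle => (u : ℂ)) :=
  Topology.IsEmbedding.subtypeVal

theorem Complex.continuousOn_dir : ContinuousOn Complex.dir {0}ᶜ := by
  rw [IsEmbedding.continuousOn_iff (β := Circle) Circle.isEmbedding_coe]
  refine ContinuousOn.congr (f := fun w : ℂ => w / ‖w‖) ?_ fun w hw => Complex.coe_dir hw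
  exact continuousOn_id.div (by fun_prop) fun w hw => by simpa using hw

@[simp] theorem Complex.dir_circle (u : Circle) : (u : ℂ).dir = u := by
  refine Circle.ext ?_
  rw [Complex.coe_dir u.coe_ne_zero, Circle.norm_coe]
  simp

/-! ### Tubular coordinates, the radial retraction, and conjugacy of meridians. -/

namespace TameKnot

variable (K : TameKnot)

/-- Tubular coordinates. -/
noncomputable def coord (x : Sphere3) : Circle × ℂ := Function.invFun K.tube x

@[simp] theorem coord_tube (p : Circle × ℂ) : K.coord (K.tube p) = p :=
  Function.leftInverse_invFun K.isOpenEmbedding_tube.injective p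

theorem continuousOn_coord : ContinuousOn K.coord (range K.tube) := by
  rintro _ ⟨p, rfl⟩
  refine ContinuousAt.continuousWithinAt ?_
  rw [← K.isOpenEmbedding_tube.continuousAt_iff]
  convert continuousAt_id
  ext1 q
  exact K.coord_tube q

theorem isOpen_tube_image {s : Set (Circle × ℂ)} (hs : IsOpen s) : IsOpen (K.tube '' s) :=
  K.isOpenEmbedding_tube.isOpenMap _ hs

theorem tube_mem_image {s : Set (Circle × ℂ)} {p : Circle × ℂ} : K.tube p ∈ K.tube '' s ↔ p ∈ s :=
  K.isOpenEmbedding_tube.injective.mem_set_image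

theorem tube_mem_core {p : Circle × ℂ} : K.tube p ∈ K.core ↔ p.2 = 0 := K.tube_mem_image

theorem tube_mem_ext {p : Circle × ℂ} : K.tube p ∈ K.exterior ↔ 1 ≤ ‖p.2‖ := by
  rw [exterior, mem_compl_iff, K.tube_mem_image]; simp

theorem isCompact_core : IsCompact K.core := by
  have : {p : Circle × ℂ | p.2 = 0} = univ ×ˢ {0} := by ext; simp
  rw [core, this]
  exact (isCompact_univ.prod isCompact_singleton).image K.isOpenEmbedding_tube.continuous

theorem isClosed_exterior : IsClosed K.exterior :=
  (K.isOpen_tube_image (isOpen_lt (by fun_prop) continuous_const)).isClosed_compl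

theorem exterior_subset : K.exterior ⊆ K.coreᶜ := by
  rintro x hx ⟨p, hp, rfl⟩
  rw [tube_mem_ext, show p.2 = 0 from hp] at hx
  simp at hx
  linarith

open Classical in
/-- The radial retraction of the complement of the knot onto its exterior. -/
noncomputable def retr (x : Sphere3) : K.exterior :=
  if h : x ∈ K.exterior then ⟨x, h⟩ else K.bdryPoint (K.coord x).1 (K.coord x).2.dir

theorem retr_of_mem (x : K.exterior) : K.retr x = x := by
  simp [retr]

theorem retr_tube {p : Circle × ℂ} (h0 : p.2 ≠ 0) (h1 : ‖p.2‖ ≤ 1) :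
    K.retr (K.tube p) = K.bdryPoint p.1 p.2.dir := by
  unfold retr
  split_ifs with h
  · rw [tube_mem_ext] at h
    apply Subtype.ext
    have : ‖p.2‖ = 1 := le_antisymm h1 h
    simp [bdryPoint, Complex.coe_dir h0, this]
  · simp

theorem continuousOn_retr : ContinuousOn K.retr K.coreᶜ := by
  rw [Topology.IsEmbedding.subtypeVal.continuousOn_iff]
  intro x hx
  refine ContinuousAt.continuousWithinAt ?_
  by_cases hr : x ∈ K.tube '' {p | ‖p.2‖ ≤ 1}
  · obtain ⟨p, hp, rfl⟩ := hr
    have hp0 : p.2 ≠ 0 := fun h => hx (K.tube_mem_core.2 h)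
    rw [← K.isOpenEmbedding_tube.continuousAt_iff]
    -- In the tube the retraction is given by this single formula inside and outside the unit torus;
    -- away from the closed torus it is the identity.
    have hc : ContinuousAt (fun q : Circle × ℂ => K.tube (q.1, q.2 / (min 1 ‖q.2‖ : ℝ))) p := by
      refine K.isOpenEmbedding_tube.continuous.continuousAt.comp ?_
      refine continuousAt_fst.prodMk (ContinuousAt.div (by fun_prop) (by fun_prop) ?_)
      have : 0 < min 1 ‖p.2‖ := lt_min one_pos (by simpa using hp0)
      exact_mod_cast this.ne'
    refine hc.congr ?_
    filter_upwards [(isOpen_ne_fun (f := fun q : Circle × ℂ => q.2) (g := fun _ => 0)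
      (by fun_prop) continuous_const).mem_nhds hp0] with q hq
    by_cases h1 : ‖q.2‖ ≤ 1
    · simp only [Function.comp_apply]
      rw [K.retr_tube hq h1, min_eq_right h1]
      simp [bdryPoint, Complex.coe_dir hq]
    · have : K.tube q ∈ K.exterior := K.tube_mem_ext.2 (not_le.1 h1).le
      simp only [Function.comp_apply]
      rw [show K.retr (K.tube q) = ⟨_, this⟩ from K.retr_of_mem ⟨_, this⟩,
        min_eq_left (not_le.1 h1).le]
      simp
  · have hcl : IsClosed (K.tube '' {p | ‖p.2‖ ≤ 1}) := by
      have : {p : Circle × ℂ | ‖p.2‖ ≤ 1} = univ ×ˢ closedBall 0 1 := by ext; simp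
      rw [this]
      exact ((isCompact_univ.prod (isCompact_closedBall _ _)).image
        K.isOpenEmbedding_tube.continuous).isClosed
    refine continuousAt_id.congr ?_
    filter_upwards [hcl.isOpen_compl.mem_nhds hr] with y hy
    have : y ∈ K.exterior := by
      rintro ⟨q, hq, rfl⟩
      exact hy ⟨q, (show ‖q.2‖ < 1 from hq).le, rfl⟩
    simp only [Function.comp_apply]
    rw [show K.retr y = ⟨_, this⟩ from K.retr_of_mem ⟨_, this⟩]
    rfl

/-- The meridian circle over `z`. -/
def meridianCircle (z : Circle) : C(Circle, K.exterior) :=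
  ⟨K.bdryPoint z, K.continuous_bdryPoint.comp (by fun_prop : Continuous fun u : Circle => (z, u))⟩

/-- The class of the meridional loop over `z`. -/
noncomputable def mer (z : Circle) : FundamentalGroup K.exterior (K.bdryPoint z 1) :=
  FundamentalGroup.fromPath (.mk (K.meridianLoop z))

theorem map_meridianCircle_stdLoop (z : Circle) :
    FundamentalGroup.map (K.meridianCircle z) 1
      (FundamentalGroup.fromPath (.mk Circle.stdLoop)) = K.mer z := rfl

/-- Replacing paths by classes lets the connecting path be composed and simplified freely. -/
theorem isMeridian_iff (g : K.Group) : K.IsMeridian g ↔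
    ∃ (z : Circle) (c : Path.Homotopic.Quotient K.basePoint (K.bdryPoint z 1)),
      g = FundamentalGroup.conjPath c (K.mer z) ∨ g = FundamentalGroup.conjPath c (K.mer z)⁻¹ := by
  constructor
  · rintro ⟨z, c, h⟩
    exact ⟨z, .mk c, h⟩
  · rintro ⟨z, c, h⟩
    induction c with
    | mk c => exact ⟨z, c, h⟩

/-- A path on the boundary torus from the base point to the meridian over `z`. -/
noncomputable def longPath (z : Circle) : Path K.basePoint (K.bdryPoint z 1) where
  toFun t := K.bdryPoint (Circle.exp (t * Complex.arg z)) 1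
  continuous_toFun := K.continuous_bdryPoint.comp (f := fun t : I =>
    (Circle.exp ((t : ℝ) * Complex.arg z), (1 : Circle))) (by fun_prop)
  source' := by simp [basePoint]
  target' := by simp [Circle.exp_arg]

/-- Sliding the meridian along the longitude is a free homotopy, and `longPath` is the trace of its
base point. -/
theorem conjPath_longPath (z : Circle) :
    FundamentalGroup.conjPath (.mk (K.longPath z)) (K.mer z) = K.mer 1 := by
  let F : (K.meridianCircle 1).Homotopy (K.meridianCircle z) :=
    ⟨⟨fun x => K.bdryPoint (Circle.exp ((x.1 : ℝ) * Complex.arg z)) x.2,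
      K.continuous_bdryPoint.comp (f := fun x : I × Circle =>
        (Circle.exp ((x.1 : ℝ) * Complex.arg z), x.2)) (by fun_prop)⟩,
      fun u => by simp [meridianCircle], fun u => by simp [meridianCircle, Circle.exp_arg]⟩
  have h := F.map_eq_conjPath (FundamentalGroup.fromPath (.mk Circle.stdLoop))
  rw [map_meridianCircle_stdLoop, map_meridianCircle_stdLoop] at h
  rw [h]
  rfl

/-- The meridian at the base point. -/
noncomputable def mer₀ : K.Group := K.mer 1

theorem isMeridian_mer₀ : K.IsMeridian K.mer₀ :=
  (K.isMeridian_iff _).2 ⟨1, .refl _, .inl (FundamentalGroup.conjPath_refl _).symm⟩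

/-- All meridians are conjugate up to inversion. -/
theorem IsMeridian.exists_conj {g : K.Group} (h : K.IsMeridian g) :
    ∃ c : K.Group, g = c⁻¹ * K.mer₀ * c ∨ g = c⁻¹ * K.mer₀⁻¹ * c := by
  obtain ⟨z, c, h⟩ := (K.isMeridian_iff g).1 h
  have h1 : K.mer z = FundamentalGroup.conjPath (Path.Homotopic.Quotient.mk (K.longPath z)).symm
      K.mer₀ := by
    rw [mer₀, ← K.conjPath_longPath z, FundamentalGroup.conjPath_conjPath]
    simp [FundamentalGroup.conjPath_refl]
  refine ⟨c.trans (Path.Homotopic.Quotient.mk (K.longPath z)).symm, h.imp ?_ ?_⟩ <;>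
  · rintro rfl
    rw [← FundamentalGroup.conjPath_self]
    simp only [map_inv, h1]
    rw [FundamentalGroup.conjPath_conjPath]

end TameKnot

/-! ### Induction over boxes and circle-valued clutching functions. -/

/-- Closed pasting relative to a set `S` that need not be closed: at a point of `S` off a closed
piece, continuity within that piece is vacuous. -/
theorem ContinuousOn.union_inter_of_isClosed {X Y : Type*} [TopologicalSpace X]
    [TopologicalSpace Y] {f : X → Y} {S A B : Set X} (hA : IsClosed A) (hB : IsClosed B)
    (h1 : ContinuousOn f (A ∩ S)) (h2 : ContinuousOn f (B ∩ S)) :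
    ContinuousOn f ((A ∪ B) ∩ S) := by
  have key (C : Set X) (hC : IsClosed C) (h : ContinuousOn f (C ∩ S)) (x : X) (hx : x ∈ S) :
      ContinuousWithinAt f (C ∩ S) x := by
    by_cases hxC : x ∈ C
    · exact h x ⟨hxC, hx⟩
    · exact continuousWithinAt_of_notMem_closure fun hc =>
        hxC (hC.closure_subset_iff.2 inter_subset_left hc)
  rw [union_inter_distrib_right]
  rintro x hx
  rw [← union_inter_distrib_right] at hx
  exact (key A hA h1 x hx.2).union (key B hB h2 x hx.2)

theorem Icc_update_union {ι : Type*} [DecidableEq ι] {a b : ι → ℝ} {i : ι} {c : ℝ} (h1 : a i ≤ c) (h2 : c ≤ b i) :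
    Icc a (Function.update b i c) ∪ Icc (Function.update a i c) b = Icc a b := by
  ext x
  simp only [mem_union, mem_Icc, le_update_iff, update_le_iff]
  constructor
  · rintro (⟨h, h', h''⟩ | ⟨⟨h, h'⟩, h''⟩)
    · refine ⟨h, fun j => ?_⟩
      by_cases hj : j = i
      · subst hj; linarith
      · exact h'' j hj
    · refine ⟨fun j => ?_, h''⟩
      by_cases hj : j = i
      · subst hj; linarith
      · exact h' j hj
  · rintro ⟨h, h'⟩
    rcases le_total (x i) c with hc | hc
    · exact .inl ⟨h, hc, fun j _ => h' j⟩
    · exact .inr ⟨⟨hc, fun j _ => h j⟩, h'⟩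

section Box

variable {ι : Type*} [Fintype ι] [DecidableEq ι]

/-- A property of boxes which holds for small boxes and passes from the two halves of a box to the
box holds for all boxes. -/
theorem box_induction {P : Set (ι → ℝ) → Prop}
    (hloc : ∀ x, ∃ ε > 0, ∀ a b, Icc a b ⊆ ball x ε → P (Icc a b))
    (hmerge : ∀ (a b : ι → ℝ) (i : ι) (c : ℝ), a i ≤ c → c ≤ b i →
      P (Icc a (Function.update b i c)) → P (Icc (Function.update a i c) b) → P (Icc a b))
    (a b : ι → ℝ) : P (Icc a b) := by
  choose ε hε hP using hloc
  obtain ⟨δ, hδ, hleb⟩ := lebesgue_number_lemma_of_metric (s := Icc a b) (c := fun x => ball x (ε x))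
    isCompact_Icc (fun _ => isOpen_ball) (fun x _ => mem_iUnion.2 ⟨x, mem_ball_self (hε x)⟩)
  -- `T` collects the directions in which the box may still be long. With `T` empty the box has
  -- diameter below the Lebesgue number.
  have key : ∀ (T : Finset ι) (a' b' : ι → ℝ), Icc a' b' ⊆ Icc a b →
      (∀ i ∉ T, b' i - a' i < δ) → P (Icc a' b') := by
    intro T
    induction T using Finset.induction_on with
    | empty =>
      intro a' b' hsub hs
      by_cases hle : a' ≤ b'
      · obtain ⟨x, hx⟩ := hleb a' (hsub ⟨le_rfl, hle⟩)
        refine hP x a' b' (Subset.trans (fun y hy => ?_) hx)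
        rw [mem_ball, dist_pi_lt_iff hδ]
        intro i
        have h1 := hy.1 i
        have h2 := hy.2 i
        rw [Real.dist_eq, abs_of_nonneg (by linarith)]
        linarith [hs i (by simp)]
      · refine hP a a' b' ?_
        rw [Icc_eq_empty hle]
        exact empty_subset _
    | insert i T hi ih =>
      -- Slabs of thickness `δ / 2` are cut off in direction `i`, and `n` bounds the number of cuts.
      have hn : ∀ (n : ℕ) (a' b' : ι → ℝ), Icc a' b' ⊆ Icc a b →
          (∀ j ∉ insert i T, b' j - a' j < δ) → b' i - a' i < (n + 1) * (δ / 2) →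
          P (Icc a' b') := by
        intro n
        induction n with
        | zero =>
          intro a' b' hsub hs hi'
          refine ih a' b' hsub fun j hj => ?_
          by_cases hji : j = i
          · subst hji; norm_num at hi'; linarith
          · exact hs j (by simp [hji, hj])
        | succ n ihn =>
          intro a' b' hsub hs hi'
          by_cases hd : b' i - a' i < δ
          · refine ih a' b' hsub fun j hj => ?_
            by_cases hji : j = i
            · subst hji; exact hd
            · exact hs j (by simp [hji, hj])
          · push Not at hd
            refine hmerge a' b' i (a' i + δ / 2) (by linarith) (by linarith) ?_ ?_
            · refine ih _ _ (Subset.trans (Icc_subset_Icc_right ?_) hsub) fun j hj => ?_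
              · rw [update_le_iff]
                exact ⟨by linarith, fun _ _ => le_rfl⟩
              · by_cases hji : j = i
                · subst hji; simp; linarith
                · rw [Function.update_of_ne hji]
                  exact hs j (by simp [hji, hj])
            · refine ihn _ _ (Subset.trans (Icc_subset_Icc_left ?_) hsub) (fun j hj => ?_) ?_
              · rw [le_update_iff]
                exact ⟨by linarith, fun _ _ => le_rfl⟩
              · have hji : j ≠ i := fun h => hj (by simp [h])
                rw [Function.update_of_ne hji]
                exact hs j hj
              · push_cast at hi'
                simp
                linarith
      intro a' b' hsub hs
      obtain ⟨n, hn'⟩ := exists_nat_gt ((b' i - a' i) / (δ / 2))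
      refine hn n a' b' hsub hs ?_
      rw [div_lt_iff₀ (by positivity)] at hn'
      linarith
  exact key Finset.univ a b Subset.rfl (by simp)

/-- Circle bundles over a box are trivial: a circle-valued clutching function for an open cover by
two sets is a quotient of functions on these sets. -/
theorem exists_circle_clutching {U W : Set (ι → ℝ)} (hU : IsOpen U) (hW : IsOpen W)
    (hUW : ∀ x, x ∈ U ∨ x ∈ W) {f : (ι → ℝ) → Circle} (hf : ContinuousOn f (U ∩ W))
    (a b : ι → ℝ) : ∃ g h : (ι → ℝ) → Circle, ContinuousOn g (Icc a b ∩ U) ∧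
      ContinuousOn h (Icc a b ∩ W) ∧ ∀ x ∈ Icc a b, x ∈ U → x ∈ W → g x = f x * h x := by
  refine box_induction (P := fun A => ∃ g h : (ι → ℝ) → Circle, ContinuousOn g (A ∩ U) ∧
      ContinuousOn h (A ∩ W) ∧ ∀ x ∈ A, x ∈ U → x ∈ W → g x = f x * h x) ?_ ?_ a b
  · intro x
    rcases hUW x with hx | hx
    · obtain ⟨ε, hε, hb⟩ := Metric.isOpen_iff.1 hU x hx
      refine ⟨ε, hε, fun a b hab => ⟨1, f⁻¹, continuousOn_const, ?_, by simp⟩⟩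
      exact (hf.mono fun y hy => ⟨hb (hab hy.1), hy.2⟩).inv
    · obtain ⟨ε, hε, hb⟩ := Metric.isOpen_iff.1 hW x hx
      refine ⟨ε, hε, fun a b hab => ⟨f, 1, ?_, continuousOn_const, by simp⟩⟩
      exact hf.mono fun y hy => ⟨hy.2, hb (hab hy.1)⟩
  · rintro a b i c hac hcb ⟨g₁, h₁, hg₁, hh₁, e₁⟩ ⟨g₂, h₂, hg₂, hh₂, e₂⟩
    classical
    let R : Set (ι → ℝ) := Icc a (Function.update b i c) ∩ Icc (Function.update a i c) b
    have hR {x : ι → ℝ} (hx : x ∈ R) : x i = c :=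
      le_antisymm (by simpa using hx.1.2 i) (by simpa using hx.2.1 i)
    -- The discrepancy of the two solutions on the common face `R`. On `U ∩ W` the factor `f`
    -- cancels, so both formulas agree there and `d` is continuous on all of `R`.
    let d : (ι → ℝ) → Circle := fun x => if x ∈ U then g₁ x / g₂ x else h₁ x / h₂ x
    have hdW {x : ι → ℝ} (hx : x ∈ R) (hxW : x ∈ W) : d x = h₁ x / h₂ x := by
      by_cases hxU : x ∈ U
      · simp only [d, hxU, if_true, e₁ x hx.1 hxU hxW, e₂ x hx.2 hxU hxW]
        exact mul_div_mul_left_eq_div _ _ _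
      · simp [d, hxU]
    have hd : ContinuousOn d R := by
      intro x hx
      rcases hUW x with hxU | hxW
      · rw [← continuousWithinAt_inter (hU.mem_nhds hxU)]
        refine (((hg₁.mono (fun y hy => ⟨hy.1.1, hy.2⟩)).div' (hg₂.mono
          (fun y hy => ⟨hy.1.2, hy.2⟩))).congr (s := R ∩ U) fun y hy => ?_) x ⟨hx, hxU⟩
        simp [d, hy.2]
      · rw [← continuousWithinAt_inter (hW.mem_nhds hxW)]
        exact (((hh₁.mono (fun y hy => ⟨hy.1.1, hy.2⟩)).div' (hh₂.mono
          (fun y hy => ⟨hy.1.2, hy.2⟩))).congr (s := R ∩ W) fun y hy => hdW hy.1 hy.2) x ⟨hx, hxW⟩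
    have hπ : MapsTo (fun x => Function.update x i c) (Icc (Function.update a i c) b) R := by
      intro x hx
      have h3 : ∀ j ≠ i, a j ≤ x j := fun j hj => by simpa [hj] using hx.1 j
      refine ⟨⟨?_, ?_⟩, ?_, ?_⟩
      · exact le_update_iff.2 ⟨hac, h3⟩
      · exact update_le_update_iff.2 ⟨le_rfl, fun j _ => hx.2 j⟩
      · exact update_le_update_iff.2 ⟨le_rfl, h3⟩
      · exact update_le_iff.2 ⟨hcb, fun j _ => hx.2 j⟩
    have hdπ : ContinuousOn (fun x => d (Function.update x i c)) (Icc (Function.update a i c) b) :=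
      hd.comp (by fun_prop) hπ
    have hupd {x : ι → ℝ} (hx : x i = c) : Function.update x i c = x := by
      rw [← hx]; exact Function.update_eq_self i x
    have hlt {x : ι → ℝ} (hx : x ∈ Icc (Function.update a i c) b) : c ≤ x i := by
      simpa using hx.1 i
    have hle {x : ι → ℝ} (hx : x ∈ Icc a (Function.update b i c)) : x i ≤ c := by
      simpa using hx.2 i
    -- The discrepancy is extended over the second half by projecting to the face; multiplying both
    -- `g₂` and `h₂` by it preserves their relation.
    refine ⟨fun x => if x i ≤ c then g₁ x else g₂ x * d (Function.update x i c),
      fun x => if x i ≤ c then h₁ x else h₂ x * d (Function.update x i c), ?_, ?_, ?_⟩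
    · rw [← Icc_update_union hac hcb]
      refine ContinuousOn.union_inter_of_isClosed isClosed_Icc isClosed_Icc
        (hg₁.congr fun x hx => if_pos (hle hx.1))
        ((hg₂.mul (hdπ.mono inter_subset_left)).congr fun x hx => ?_)
      by_cases hc : x i ≤ c
      · have hxc := le_antisymm hc (hlt hx.1)
        simp [hxc, hupd hxc, d, hx.2]
      · simp [hc]
    · rw [← Icc_update_union hac hcb]
      refine ContinuousOn.union_inter_of_isClosed isClosed_Icc isClosed_Icc
        (hh₁.congr fun x hx => if_pos (hle hx.1))
        ((hh₂.mul (hdπ.mono inter_subset_left)).congr fun x hx => ?_)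
      by_cases hc : x i ≤ c
      · have hxc := le_antisymm hc (hlt hx.1)
        have hxR : x ∈ R := by simpa only [hupd hxc] using hπ hx.1
        simp [hxc, hupd hxc, hdW hxR hx.2]
      · simp [hc]
    · intro x hx hxU hxW
      rw [← Icc_update_union hac hcb] at hx
      by_cases hc : x i ≤ c
      · simp only [hc, if_true]
        rcases hx with hx | hx
        · exact e₁ x hx hxU hxW
        · have hxc := le_antisymm hc (hlt hx)
          have hxR : x ∈ R := by simpa only [hupd hxc] using hπ hx
          exact e₁ x hxR.1 hxU hxW
      · have hx2 := hx.resolve_left fun h => hc (hle h)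
        simp only [hc, if_false, e₂ x hx2 hxU hxW, mul_assoc]

end Box

/-! ### The mod 2 linking character. -/

/-- Coordinates on the complement of a point of the 3-sphere. -/
theorem Sphere3.exists_coordinates (p : Sphere3) :
    ∃ (s : (Fin 3 → ℝ) → Sphere3) (ψ : Sphere3 → Fin 3 → ℝ), Continuous s ∧
      ContinuousOn ψ {p}ᶜ ∧ (∀ x, s x ≠ p) ∧ (∀ x, ψ (s x) = x) ∧ ∀ y ≠ p, s (ψ y) = y := by
  have : Fact (Module.finrank ℝ (EuclideanSpace ℝ (Fin 4)) = 3 + 1) := ⟨by simp⟩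
  let e := stereographic' 3 p
  let l := EuclideanSpace.equiv (Fin 3) ℝ
  have ht (x) : x ∈ e.target := by simp [e]
  have hsrc {y} : y ∈ e.source ↔ y ≠ p := by simp [e]
  refine ⟨fun x => e.symm (l.symm x), fun y => l (e y), ?_, ?_, fun x => ?_, fun x => ?_,
    fun y hy => ?_⟩
  · exact e.continuousOn_symm.comp_continuous l.symm.continuous fun x => ht _
  · exact l.continuous.comp_continuousOn (e.continuousOn.mono fun y hy => hsrc.2 hy)
  · exact hsrc.1 (e.map_target (ht _))
  · simp [e.right_inv (ht _)]
  · simp [e.left_inv (hsrc.2 hy)]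

/-- Composition of an antihomomorphism with a homomorphism to a commutative group. -/
def MonoidHom.compUnop {G H A : Type*} [Group G] [Group H] [CommGroup A] (F : H →* A)
    (f : G →* Hᵐᵒᵖ) : G →* A where
  toFun g := F (f g).unop
  map_one' := by simp
  map_mul' x y := by simp [mul_comm]

/-- The character `exp (i π · winding number)` of the fundamental group of the circle. -/
theorem Circle.exists_halfWinding (c : Circle) : ∃ F : FundamentalGroup Circle c →* Circle,
    (∀ γ, F γ * F γ = 1) ∧ ∀ (L : C(I, ℝ)) (γ : Path c c), (∀ t, Circle.exp (L t) = γ t) →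
      F (FundamentalGroup.fromPath (.mk γ)) = Circle.exp ((L 1 - L 0) / 2) := by
  let h := Circle.isAddQuotientCoveringMap_exp
  let e : Circle.exp ⁻¹' {c} := ⟨Complex.arg c, Circle.exp_arg c⟩
  -- A deck translation by `2πn` goes to `exp (iπn) = (-1)^n`.
  let F₀ : Multiplicative (AddSubgroup.zmultiples (2 * Real.pi)) →* Circle :=
    { toFun := fun x => Circle.exp ((x.toAdd : ℝ) / 2)
      map_one' := by simp
      map_mul' := fun x y => by simp [add_div, Circle.exp_add] }
  let F : FundamentalGroup Circle c →* Circle := F₀.compUnop (h.fundamentalGroupToMulOpposite e)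
  refine ⟨F, fun γ => ?_, fun L γ hL => ?_⟩
  · change Circle.exp _ * Circle.exp _ = 1
    rw [← Circle.exp_add, add_halves]
    obtain ⟨n, hn⟩ := (h.fundamentalGroupToMulOpposite e γ).unop.toAdd.2
    simp only at hn
    rw [← hn, Circle.exp_eq_one]
    exact ⟨n, by simp⟩
  · have hsm := h.unop_fundamentalGroupToMulOpposite_smul (e := e)
      (γ := FundamentalGroup.fromPath (.mk γ))
    have h0 : Circle.exp (Complex.arg c) = Circle.exp (L 0) := by
      rw [hL, γ.source, Circle.exp_arg]
    obtain ⟨m, hm⟩ := Circle.exp_eq_exp.1 h0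
    -- The given lift `L` may start on another sheet than `e`; shifting it by `2πm` corrects this
    -- and leaves `L 1 - L 0` unchanged.
    have hm1 : (h.isCoveringMap.monodromy (.mk γ) e).1 = L 1 + m * (2 * Real.pi) := by
      have := h.isCoveringMap.monodromy_eq_of_map_eq (γ := .mk γ) (ex := e)
        (ey := ⟨L 1 + m * (2 * Real.pi), by
          simp only [mem_preimage, mem_singleton_iff]
          rw [Circle.exp_add, hL, γ.target, Circle.exp_int_mul_two_pi, mul_one]⟩)
        (.mk ⟨⟨fun t => L t + m * (2 * Real.pi), by fun_prop⟩, by simp [e, hm], by simp⟩) (by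
          refine congrArg Path.Homotopic.Quotient.mk ?_
          ext t
          simp [hL, Circle.exp_add]
          rfl)
      rw [this]
    change Circle.exp _ = _
    have h2 := hsm.trans hm1
    change ((h.fundamentalGroupToMulOpposite e (FundamentalGroup.fromPath (.mk γ))).unop.toAdd : ℝ)
      + Complex.arg c = _ at h2
    congr 2
    linarith

/-- Every circle-valued function on the plane has a continuous logarithm. -/
theorem Complex.exists_circle_lift (k : C(ℂ, Circle)) : ∃ κ : C(ℂ, ℝ), ∀ w, Circle.exp (κ w) = k w := by
  obtain ⟨F, hF, -⟩ := Circle.isCoveringMap_exp.existsUnique_continuousMap_lifts k 0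
    (Complex.arg (k 0)) (Circle.exp_arg _)
  exact ⟨F, fun w => congrFun hF.2 w⟩

namespace TameKnot

variable (K : TameKnot)

theorem isOpen_compl_core : IsOpen K.coreᶜ := K.isCompact_core.isClosed.isOpen_compl

theorem tube_ne_tube {p q : Circle × ℂ} (h : p ≠ q) : K.tube p ≠ K.tube q :=
  fun e => h (K.isOpenEmbedding_tube.injective e)

/-- A map from the exterior to the circle of degree one on a meridian. -/
theorem exists_circle_map : ∃ (G : C(K.exterior, Circle)) (κ : C(ℂ, ℝ)),
    ∀ w : Circle, G (K.bdryPoint 1 w) = w * Circle.exp (κ w) := by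
  -- The point sent to infinity lies on the knot but not on the meridian disc over `1`, so the
  -- exterior and that disc both land in a box.
  obtain ⟨s, ψ, hs, hψ, hsp, hψs, hsψ⟩ := Sphere3.exists_coordinates (K.tube (-1, 0))
  have hU : IsOpen (s ⁻¹' K.coreᶜ) := K.isOpen_compl_core.preimage hs
  have hW : IsOpen (s ⁻¹' range K.tube) := K.isOpenEmbedding_tube.isOpen_range.preimage hs
  have hUW : ∀ x, x ∈ s ⁻¹' K.coreᶜ ∨ x ∈ s ⁻¹' range K.tube := fun x => by
    by_cases h : s x ∈ K.core
    · exact .inr (image_subset_range _ _ h)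
    · exact .inl h
  have hf : ContinuousOn (fun x => (K.coord (s x)).2.dir)
      (s ⁻¹' K.coreᶜ ∩ s ⁻¹' range K.tube) := by
    refine Complex.continuousOn_dir.comp (continuous_snd.comp_continuousOn
      (K.continuousOn_coord.comp hs.continuousOn fun x hx => hx.2)) ?_
    rintro x ⟨hx, p, hp⟩ h0
    simp only [mem_singleton_iff, ← hp, coord_tube] at h0
    exact hx (by rw [← hp]; exact K.tube_mem_core.2 h0)
  let disc : Set Sphere3 := K.tube '' ({1} ×ˢ closedBall 0 1)
  have hZ : IsCompact (K.exterior ∪ disc) := K.isClosed_exterior.isCompact.union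
    ((isCompact_singleton.prod (isCompact_closedBall _ _)).image
      K.isOpenEmbedding_tube.continuous)
  have hZp : K.exterior ∪ disc ⊆ {K.tube (-1, 0)}ᶜ := by
    rintro x (hx | ⟨q, hq, rfl⟩) hxp
    · rw [mem_singleton_iff] at hxp
      rw [hxp, tube_mem_ext] at hx
      simp at hx
      linarith
    · refine K.tube_ne_tube (fun h => ?_) hxp
      have h1 := hq.1
      rw [h] at h1
      simp only [mem_singleton_iff] at h1
      have h2 := congrArg (fun u : Circle => (u : ℂ).re) h1
      norm_num at h2
  have hψZ : IsCompact (ψ '' (K.exterior ∪ disc)) := hZ.image_of_continuousOn (hψ.mono hZp)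
  obtain ⟨a, b, hab⟩ := bddBelow_bddAbove_iff_subset_Icc.1
    ⟨hψZ.isBounded.bddBelow, hψZ.isBounded.bddAbove⟩
  -- `g` lives off the knot and becomes `G`. `h` lives on the whole tube, in particular on the
  -- meridian disc, and therefore has degree zero on its boundary.
  obtain ⟨g, h, hg, hh, e⟩ := exists_circle_clutching hU hW hUW hf a b
  have hext (x : K.exterior) : (x : Sphere3) ≠ K.tube (-1, 0) := hZp (.inl x.2)
  let G : C(K.exterior, Circle) := ⟨fun x => g (ψ x), hg.comp_continuous
    (hψ.comp_continuous continuous_subtype_val hext) fun x =>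
      ⟨hab ⟨x, .inl x.2, rfl⟩, by
        rw [mem_preimage, hsψ _ (hext x)]; exact K.exterior_subset x.2⟩⟩
  have hdisc (w : ℂ) : K.tube (1, w / (max 1 ‖w‖ : ℝ)) ∈ disc := by
    refine ⟨_, mem_prod.2 ⟨mem_singleton _, ?_⟩, rfl⟩
    rw [mem_closedBall_zero_iff, norm_div, Complex.norm_real, Real.norm_eq_abs, abs_of_pos
      (lt_max_of_lt_left one_pos)]
    exact div_le_one_of_le₀ (le_max_right _ _) (by positivity)
  have hcont : Continuous fun w : ℂ => K.tube (1, w / (max 1 ‖w‖ : ℝ)) := by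
    refine K.isOpenEmbedding_tube.continuous.comp (continuous_const.prodMk
      (continuous_id.div (by fun_prop) fun w => ?_))
    exact_mod_cast (lt_max_of_lt_left one_pos : 0 < max 1 ‖w‖).ne'
  -- Retracting the plane onto the unit disc makes `h` a function on a simply connected space, where
  -- it has a logarithm.
  let k : C(ℂ, Circle) := ⟨fun w => h (ψ (K.tube (1, w / (max 1 ‖w‖ : ℝ)))),
    hh.comp_continuous (hψ.comp_continuous hcont fun w => hZp (.inr (hdisc w))) fun w =>
      ⟨hab ⟨_, .inr (hdisc w), rfl⟩, by
        rw [mem_preimage, hsψ _ (hZp (.inr (hdisc w)))]; exact mem_range_self _⟩⟩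
  obtain ⟨κ, hκ⟩ := Complex.exists_circle_lift k
  refine ⟨G, κ, fun w => ?_⟩
  have hx := hext (K.bdryPoint 1 w)
  rw [hκ]
  change g (ψ (K.tube (1, w))) = w * h (ψ (K.tube (1, w / (max 1 ‖(w : ℂ)‖ : ℝ))))
  change K.tube (1, w) ≠ _ at hx
  rw [e _ (hab ⟨_, .inl (K.tube_mem_exterior 1 w), rfl⟩)]
  · rw [hsψ _ hx]
    simp only [coord_tube, Complex.dir_circle, Circle.norm_coe, max_self, Complex.ofReal_one,
      div_one]
  · rw [mem_preimage, hsψ _ hx]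
    exact K.exterior_subset (K.tube_mem_exterior 1 w)
  · rw [mem_preimage, hsψ _ hx]
    exact mem_range_self _

/-- The mod 2 linking number with the knot. -/
theorem exists_linking_character : ∃ χ : K.Group →* Circle, (∀ g, χ g * χ g = 1) ∧
    ∀ m, K.IsMeridian m → χ m = Circle.exp Real.pi := by
  obtain ⟨G, κ, hG⟩ := K.exists_circle_map
  obtain ⟨F, hF2, hF⟩ := Circle.exists_halfWinding (G K.basePoint)
  let χ : K.Group →* Circle := F.comp (FundamentalGroup.map G K.basePoint)
  have h0 : χ K.mer₀ = Circle.exp Real.pi := by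
    -- A lift of the image of the meridian: the `κ` terms at the two ends cancel, which leaves `2π /
    -- 2 = π`.
    have := hF ⟨fun t => 2 * Real.pi * t + κ (Circle.exp (2 * Real.pi * t)), by fun_prop⟩
      ((K.meridianLoop 1).map G.continuous) fun t => by
        change _ = G (K.bdryPoint 1 (Circle.exp (2 * Real.pi * t)))
        rw [hG]
        simp [Circle.exp_add]
    refine this.trans ?_
    congr 1
    simp
  refine ⟨χ, fun g => hF2 _, fun m hm => ?_⟩
  have hinv : (Circle.exp Real.pi)⁻¹ = Circle.exp Real.pi := by
    rw [inv_eq_iff_mul_eq_one, ← h0]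
    exact hF2 _
  obtain ⟨c, h | h⟩ := hm.exists_conj
  · rw [h, map_mul, map_mul, map_inv, h0, mul_comm, mul_inv_cancel_left]
  · rw [h, map_mul, map_mul, map_inv, map_inv, h0, mul_comm, mul_inv_cancel_left, hinv]

end TameKnot

/-! ### Flat sections of local systems over a box. -/

section FlatSection

variable {V A : Type*} [TopologicalSpace V] [CommGroup A]

/-- A function on `Q` is flat over `O` if it is locally given by the transport `τ`. -/
def IsFlatOn (τ : V → V → A) (O Q : Set V) (s : V → A) : Prop :=
  ∀ x ∈ Q, x ∈ O → ∀ᶠ y in 𝓝[Q] x, s y = s x * τ x y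

/-- A constant factor does not affect flatness, since `A` is commutative; closedness of the pieces
makes the condition at a point off a piece vacuous. -/
theorem IsFlatOn.union {τ : V → V → A} {O P Q : Set V} {s s₁ s₂ : V → A} {k : A}
    (hP : IsClosed P) (hQ : IsClosed Q) (h₁ : IsFlatOn τ O P s₁) (h₂ : IsFlatOn τ O Q s₂)
    (e₁ : ∀ x ∈ P, s x = s₁ x) (e₂ : ∀ x ∈ Q, s x = s₂ x * k) : IsFlatOn τ O (P ∪ Q) s := by
  intro x _ hxO
  rw [nhdsWithin_union, Filter.eventually_sup]
  constructor
  · by_cases hxP : x ∈ P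
    · filter_upwards [h₁ x hxP hxO, self_mem_nhdsWithin] with y hy hyP
      rw [e₁ y hyP, e₁ x hxP, hy]
    · filter_upwards [self_mem_nhdsWithin, mem_nhdsWithin_of_mem_nhds (hP.isOpen_compl.mem_nhds hxP)]
        with y hy hy' using absurd hy hy'
  · by_cases hxQ : x ∈ Q
    · filter_upwards [h₂ x hxQ hxO, self_mem_nhdsWithin] with y hy hyQ
      rw [e₂ y hyQ, e₂ x hxQ, hy, mul_right_comm]
    · filter_upwards [self_mem_nhdsWithin, mem_nhdsWithin_of_mem_nhds (hQ.isOpen_compl.mem_nhds hxQ)]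
        with y hy hy' using absurd hy hy'

theorem IsFlatOn.div_eventually {τ : V → V → A} {O P Q : Set V} {s₁ s₂ : V → A}
    (h₁ : IsFlatOn τ O P s₁) (h₂ : IsFlatOn τ O Q s₂) {x : V} (hx : x ∈ P ∩ Q) (hxO : x ∈ O) :
    ∀ᶠ y in 𝓝[P ∩ Q] x, s₁ y / s₂ y = s₁ x / s₂ x := by
  filter_upwards [nhdsWithin_mono x inter_subset_left (h₁ x hx.1 hxO),
    nhdsWithin_mono x inter_subset_right (h₂ x hx.2 hxO)] with y hy1 hy2
  rw [hy1, hy2, mul_div_mul_right_eq_div]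

/-- The quotient of two flat sections is locally constant, hence constant on the preconnected
overlap; rescaling one section by it makes them agree. -/
theorem IsFlatOn.exists_union {τ₁ τ₂ : V → V → A} {U W P Q : Set V} (hUW : ∀ x, x ∈ U ∨ x ∈ W)
    (hP : IsClosed P) (hQ : IsClosed Q) (hPQ : IsPreconnected (P ∩ Q))
    (h₁ : ∃ s, IsFlatOn τ₁ U P s ∧ IsFlatOn τ₂ W P s)
    (h₂ : ∃ s, IsFlatOn τ₁ U Q s ∧ IsFlatOn τ₂ W Q s) :
    ∃ s, IsFlatOn τ₁ U (P ∪ Q) s ∧ IsFlatOn τ₂ W (P ∪ Q) s := by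
  classical
  obtain ⟨s₁, h₁, h₁'⟩ := h₁
  obtain ⟨s₂, h₂, h₂'⟩ := h₂
  obtain ⟨k, hk⟩ : ∃ k, ∀ x ∈ P ∩ Q, s₁ x / s₂ x = k := by
    rcases (P ∩ Q).eq_empty_or_nonempty with h | ⟨x₀, hx₀⟩
    · exact ⟨1, by simp [h]⟩
    · refine ⟨s₁ x₀ / s₂ x₀, fun x hx => ?_⟩
      -- With the discrete topology, local constancy is continuity.
      let _ : TopologicalSpace A := ⊥
      have : DiscreteTopology A := ⟨rfl⟩
      refine hPQ.constant (f := fun x => s₁ x / s₂ x) (fun y hy => ?_) hx hx₀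
      refine (continuousWithinAt_const (b := s₁ y / s₂ y)).congr_of_eventuallyEq ?_ rfl
      rcases hUW y with h | h
      · exact h₁.div_eventually h₂ hy h
      · exact h₁'.div_eventually h₂' hy h
  have e₂ : ∀ x ∈ Q, (if x ∈ P then s₁ x else s₂ x * k) = s₂ x * k := by
    intro x hx
    split_ifs with hxP
    · rw [← hk x ⟨hxP, hx⟩, mul_div_cancel]
    · rfl
  exact ⟨fun x => if x ∈ P then s₁ x else s₂ x * k,
    h₁.union hP hQ h₂ (fun x hx => if_pos hx) e₂, h₁'.union hP hQ h₂' (fun x hx => if_pos hx) e₂⟩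

end FlatSection

section

variable {ι A : Type*} [Fintype ι] [CommGroup A]

/-- In a ball inside `U`, transport from the centre is a flat section. It is also flat for `τ'`,
because the two transports agree on small balls in `U ∩ W`. -/
theorem exists_isFlatOn_of_ball {τ τ' : (ι → ℝ) → (ι → ℝ) → A} {U W : Set (ι → ℝ)} (hW : IsOpen W)
    (hτ : ∀ C ⊆ U, Convex ℝ C → ∀ x ∈ C, ∀ y ∈ C, ∀ z ∈ C, τ x y * τ y z = τ x z)
    (hττ' : ∀ C ⊆ U ∩ W, Convex ℝ C → ∀ x ∈ C, ∀ y ∈ C, τ x y = τ' x y)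
    {x : ι → ℝ} {ε : ℝ} (hb : ball x ε ⊆ U) {Q : Set (ι → ℝ)} (hQ : Q ⊆ ball x ε) :
    ∃ s, IsFlatOn τ U Q s ∧ IsFlatOn τ' W Q s := by
  rcases Q.eq_empty_or_nonempty with rfl | ⟨y₀, hy₀⟩
  · exact ⟨1, by simp [IsFlatOn], by simp [IsFlatOn]⟩
  have hx : x ∈ ball x ε := mem_ball_self (pos_of_mem_ball (hQ hy₀))
  have key (y : ι → ℝ) (hy : y ∈ Q) (z : ι → ℝ) (hz : z ∈ Q) : τ x z = τ x y * τ y z :=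
    (hτ _ hb (convex_ball x ε) x hx y (hQ hy) z (hQ hz)).symm
  refine ⟨τ x, fun y hy _ => ?_, fun y hy hyW => ?_⟩
  · filter_upwards [self_mem_nhdsWithin] with z hz using key y hy z hz
  · obtain ⟨δ, hδ, hsub⟩ := Metric.isOpen_iff.1 (isOpen_ball.inter hW) y ⟨hQ hy, hyW⟩
    filter_upwards [self_mem_nhdsWithin, mem_nhdsWithin_of_mem_nhds (ball_mem_nhds y hδ)]
      with z hz hz'
    rw [key y hy z hz, hττ' (ball y δ) (hsub.trans (inter_subset_inter_left _ hb))
      (convex_ball y δ) y (mem_ball_self hδ) z hz']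

/-- Local systems over a box are trivial. -/
theorem exists_isFlatOn_box [DecidableEq ι] {τ₁ τ₂ : (ι → ℝ) → (ι → ℝ) → A} {U W : Set (ι → ℝ)}
    (hU : IsOpen U) (hW : IsOpen W) (hUW : ∀ x, x ∈ U ∨ x ∈ W)
    (h₁ : ∀ C ⊆ U, Convex ℝ C → ∀ x ∈ C, ∀ y ∈ C, ∀ z ∈ C, τ₁ x y * τ₁ y z = τ₁ x z)
    (h₂ : ∀ C ⊆ W, Convex ℝ C → ∀ x ∈ C, ∀ y ∈ C, ∀ z ∈ C, τ₂ x y * τ₂ y z = τ₂ x z)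
    (h₁₂ : ∀ C ⊆ U ∩ W, Convex ℝ C → ∀ x ∈ C, ∀ y ∈ C, τ₁ x y = τ₂ x y) (a b : ι → ℝ) :
    ∃ s, IsFlatOn τ₁ U (Icc a b) s ∧ IsFlatOn τ₂ W (Icc a b) s := by
  refine box_induction (P := fun Q => ∃ s, IsFlatOn τ₁ U Q s ∧ IsFlatOn τ₂ W Q s) ?_ ?_ a b
  · intro x
    rcases hUW x with hx | hx
    · obtain ⟨ε, hε, hb⟩ := Metric.isOpen_iff.1 hU x hx
      exact ⟨ε, hε, fun a b hab => exists_isFlatOn_of_ball hW h₁ h₁₂ hb hab⟩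
    · obtain ⟨ε, hε, hb⟩ := Metric.isOpen_iff.1 hW x hx
      refine ⟨ε, hε, fun a b hab => ?_⟩
      obtain ⟨s, hs, hs'⟩ := exists_isFlatOn_of_ball hU h₂ (fun C hC hc x hx y hy =>
        (h₁₂ C (hC.trans (inter_comm W U).subset) hc x hx y hy).symm) hb hab
      exact ⟨s, hs', hs⟩
  · intro a b i c hac hcb hP hQ
    rw [← Icc_update_union hac hcb]
    refine IsFlatOn.exists_union hUW isClosed_Icc isClosed_Icc ?_ hP hQ
    exact ((convex_Icc _ _).inter (convex_Icc _ _)).isPreconnected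

end

/-! ### Transports: characters extended to all paths. -/

/-- A multiplicative function on homotopy classes of paths. -/
def IsTransport {X A : Type*} [TopologicalSpace X] [CommGroup A]
    (Φ : ∀ x y : X, Path.Homotopic.Quotient x y → A) : Prop :=
  ∀ x y z (p : Path.Homotopic.Quotient x y) (q : Path.Homotopic.Quotient y z),
    Φ x z (p.trans q) = Φ x y p * Φ y z q

namespace IsTransport

variable {X Y A : Type*} [TopologicalSpace X] [TopologicalSpace Y] [CommGroup A]
  {Φ : ∀ x y : X, Path.Homotopic.Quotient x y → A}

theorem refl (h : IsTransport Φ) (x : X) : Φ x x (.refl x) = 1 := by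
  have := h x x x (.refl x) (.refl x)
  simpa using this

theorem symm (h : IsTransport Φ) {x y : X} (p : Path.Homotopic.Quotient x y) :
    Φ y x p.symm = (Φ x y p)⁻¹ := by
  rw [eq_inv_iff_mul_eq_one, ← h, Path.Homotopic.Quotient.symm_trans, h.refl]

/-- The contributions of `p` and its reverse cancel because `A` is commutative. -/
theorem conjPath (h : IsTransport Φ) {x y : X} (p : Path.Homotopic.Quotient x y)
    (g : FundamentalGroup X y) : Φ x x (FundamentalGroup.conjPath p g) = Φ y y g := by
  rw [FundamentalGroup.conjPath_apply, h, h, h.symm, mul_comm, inv_mul_cancel_left]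

theorem map (h : IsTransport Φ) (f : C(Y, X)) :
    IsTransport (fun x y p => Φ (f x) (f y) (Path.Homotopic.Quotient.map p f)) := by
  intro x y z p q
  rw [← h]
  induction p with | mk p =>
  induction q with | mk q =>
  exact congrArg (fun r => Φ _ _ (Path.Homotopic.Quotient.mk r)) (Path.map_trans p q f.continuous)

theorem gauge (h : IsTransport Φ) (l : X → A) :
    IsTransport (fun x y p => l x * Φ x y p * (l y)⁻¹) := by
  intro x y z p q
  simp only [h x y z]
  rw [mul_assoc (l x * Φ x y p), mul_assoc (l y), inv_mul_cancel_left]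
  simp only [mul_assoc]

/-- Characters of the fundamental group extend to transports. -/
theorem exists_of_character (x₀ : X) (χ : FundamentalGroup X x₀ →* A) :
    ∃ Φ : ∀ x y : X, Path.Homotopic.Quotient x y → A, IsTransport Φ ∧ ∀ g, Φ x₀ x₀ g = χ g := by
  classical
  let J (x : X) := Nonempty (Path.Homotopic.Quotient x₀ x)
  -- Paths are closed up by chosen paths from `x₀`. No path joins the component of `x₀` to the rest,
  -- so the value `1` elsewhere stays multiplicative.
  let Φ (x y : X) (p : Path.Homotopic.Quotient x y) : A := if h : J x ∧ J y then
    χ (FundamentalGroup.fromPath ((h.1.some.trans p).trans h.2.some.symm)) else 1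
  have hJ {x y : X} (p : Path.Homotopic.Quotient x y) : J x ↔ J y :=
    ⟨fun ⟨q⟩ => ⟨q.trans p⟩, fun ⟨q⟩ => ⟨q.trans p.symm⟩⟩
  refine ⟨Φ, fun x y z p q => ?_, fun g => ?_⟩
  · by_cases hx : J x
    · have hy := (hJ p).1 hx
      have hz := (hJ q).1 hy
      simp only [Φ, hx, hy, hz, and_self, dif_pos]
      rw [mul_comm, ← map_mul, FundamentalGroup.mul_def]
      congr 1
      simp only [Path.Homotopic.Quotient.trans_assoc]
      rw [← Path.Homotopic.Quotient.trans_assoc hy.some.symm]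
      simp
    · have hy : ¬ J y := fun h => hx ((hJ p).2 h)
      simp [Φ, hx, hy]
  · have h : J x₀ := ⟨.refl _⟩
    simp only [Φ, h, and_self, dif_pos]
    change χ (FundamentalGroup.conjPath (FundamentalGroup.toPath (h.some)) g) = χ g
    rw [FundamentalGroup.conjPath_self, map_mul, map_mul, map_inv, mul_right_comm, inv_mul_cancel,
      one_mul]

open Classical in
/-- Transport along the image of the straight segment from `a` to `b`. -/
noncomputable def alongSegment {V : Type*} [AddCommGroup V] [Module ℝ V]
    (Φ : ∀ x y : X, Path.Homotopic.Quotient x y → A) (R : V → X) (a b : V) : A :=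
  if h : Continuous fun t : I => R (AffineMap.lineMap a b (t : ℝ)) then
    Φ (R a) (R b) (.mk ⟨⟨_, h⟩, by simp, by simp⟩) else 1

/-- In a convex set every path is homotopic to the segment between its ends, so transport depends on
the endpoints only. -/
theorem alongSegment_eq {V : Type*} [AddCommGroup V] [Module ℝ V] [TopologicalSpace V]
    [IsTopologicalAddGroup V] [ContinuousSMul ℝ V] {C : Set V} (hC : Convex ℝ C) {R : V → X}
    (hR : ContinuousOn R C) {x y : X} (p : Path x y) (p' : I → V) (hp' : Continuous p')
    (hpC : ∀ t, p' t ∈ C) (hp : ∀ t, p t = R (p' t)) :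
    Φ x y (.mk p) = alongSegment Φ R (p' 0) (p' 1) := by
  obtain rfl : x = R (p' 0) := by rw [← hp, p.source]
  obtain rfl : y = R (p' 1) := by rw [← hp, p.target]
  have hmem (t : I) : AffineMap.lineMap (p' 0) (p' 1) (t : ℝ) ∈ C :=
    hC.lineMap_mem (hpC 0) (hpC 1) t.2
  have hl : Continuous fun t : I => AffineMap.lineMap (p' 0) (p' 1) (t : ℝ) := by
    simp only [AffineMap.lineMap_apply, vsub_eq_sub, vadd_eq_add]
    fun_prop
  have h : Continuous fun t : I => R (AffineMap.lineMap (p' 0) (p' 1) (t : ℝ)) :=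
    hR.comp_continuous hl hmem
  rw [alongSegment, dif_pos h]
  congr 1
  exact Path.Homotopic.mk_eq_of_convex hC hR _ _ p' _ hp' hl hpC hmem (by simp) (by simp) hp
    fun t => rfl

theorem alongSegment_mul (hΦ : IsTransport Φ) {V : Type*} [AddCommGroup V] [Module ℝ V]
    [TopologicalSpace V] [IsTopologicalAddGroup V] [ContinuousSMul ℝ V] {C : Set V}
    (hC : Convex ℝ C) {R : V → X} (hR : ContinuousOn R C) {a b c : V} (ha : a ∈ C) (hb : b ∈ C)
    (hc : c ∈ C) : alongSegment Φ R a b * alongSegment Φ R b c = alongSegment Φ R a c := by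
  have := hC.contractibleSpace ⟨a, ha⟩
  let R' : C(C, X) := ⟨fun x => R x, hR.comp_continuous continuous_subtype_val fun x => x.2⟩
  have key (u v : C) (p : Path.Homotopic.Quotient u v) :
      Φ (R u) (R v) (p.map R') = alongSegment Φ R u v := by
    induction p with
    | mk p =>
    refine (alongSegment_eq hC hR (p.map R'.continuous) (fun t => (p t : V)) (by fun_prop)
      (fun t => (p t).2) (fun t => rfl)).trans ?_
    simp
  have p : Path.Homotopic.Quotient (⟨a, ha⟩ : C) ⟨b, hb⟩ := .mk (PathConnectedSpace.somePath _ _)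
  have q : Path.Homotopic.Quotient (⟨b, hb⟩ : C) ⟨c, hc⟩ := .mk (PathConnectedSpace.somePath _ _)
  have h := hΦ.map R' _ _ _ p q
  exact ((key _ _ _).symm.trans (h.trans (congrArg₂ _ (key _ _ _) (key _ _ _)))).symm

end IsTransport

theorem Path.Homotopic.Quotient.apply_cast {X A : Type*} [TopologicalSpace X]
    (Φ : ∀ x y : X, Path.Homotopic.Quotient x y → A) {x y x' y' : X}
    (p : Path.Homotopic.Quotient x y) (hx : x' = x) (hy : y' = y) :
    Φ x' y' (p.cast hx hy) = Φ x y p := by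
  subst hx hy
  simp

/-! ### Characters that are trivial on meridians. -/

namespace TameKnot

variable (K : TameKnot) {A : Type*} [CommGroup A]
  {Φ : ∀ x y : K.exterior, Path.Homotopic.Quotient x y → A}

/-- Transport along the arc of the meridian over `z` from angle `0` to angle `θ`. -/
noncomputable def arcTransport (Φ : ∀ x y : K.exterior, Path.Homotopic.Quotient x y → A)
    (z : Circle) (θ : ℝ) : A :=
  Φ _ _ ((Path.Homotopic.Quotient.mk (Path.segment 0 θ)).map
    ((K.meridianCircle z).comp Circle.exp))

/-- A full turn contributes `1`, and the rest of the arc is the arc to `θ` shifted by a period of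
the exponential. Thus transport depends on the point reached and not on its angle. -/
theorem arcTransport_periodic (hΦ : IsTransport Φ) (z : Circle) (hz : Φ _ _ (K.mer z) = 1) :
    Function.Periodic (K.arcTransport Φ z) (2 * Real.pi) := by
  intro θ
  let f : C(ℝ, K.exterior) := (K.meridianCircle z).comp Circle.exp
  let β (a b : ℝ) : A := Φ _ _ ((Path.Homotopic.Quotient.mk (Path.segment a b)).map f)
  have hβ (a b c : ℝ) : β a c = β a b * β b c := by
    rw [← hΦ.map f]
    simp only [β]
    congr 1
    congr 1
    exact Subsingleton.elim _ _
  have hsh : β (2 * Real.pi) (θ + 2 * Real.pi) = β 0 θ := by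
    let sh : C(ℝ, ℝ) := ⟨fun x => x + 2 * Real.pi, by fun_prop⟩
    have e : f.comp sh = f := by
      ext1 x
      simp [f, sh, Circle.exp_add]
    have e2 : Φ _ _ ((Path.Homotopic.Quotient.mk (Path.segment 0 θ)).map (f.comp sh)) = β 0 θ := by
      rw [e]
    rw [← e2]
    have e3 : β (sh 0) (sh θ) =
        Φ _ _ (((Path.Homotopic.Quotient.mk (Path.segment 0 θ)).map sh).map f) :=
      congrArg (fun q : Path.Homotopic.Quotient (sh 0) (sh θ) => Φ _ _ (q.map f))
        (Subsingleton.elim _ _)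
    have e4 : sh 0 = 2 * Real.pi := zero_add _
    have e5 : β (2 * Real.pi) (sh θ) = β (sh 0) (sh θ) := by rw [e4]
    exact e5.trans e3
  have hfull : β 0 (2 * Real.pi) = 1 := by
    rw [← hz]
    have h1 : f 0 = K.bdryPoint z 1 := by simp [f, meridianCircle]
    have h2 : f (2 * Real.pi) = K.bdryPoint z 1 := by simp [f, meridianCircle]
    rw [← Path.Homotopic.Quotient.apply_cast Φ _ h1 h2]
    simp only [β]
    congr 1
    refine congrArg Path.Homotopic.Quotient.mk ?_
    refine Path.ext (funext fun t => ?_)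
    change K.bdryPoint z (Circle.exp (AffineMap.lineMap 0 (2 * Real.pi) (t : ℝ))) =
      K.bdryPoint z (Circle.exp (2 * Real.pi * (t : ℝ)))
    simp [AffineMap.lineMap_apply, mul_comm]
  change β 0 (θ + 2 * Real.pi) = β 0 θ
  rw [hβ 0 (2 * Real.pi), hfull, one_mul, hsh]

/-- The gauge transformation that trivializes a transport on all meridians. -/
noncomputable def meridianGauge (Φ : ∀ x y : K.exterior, Path.Homotopic.Quotient x y → A)
    (x : K.exterior) : A :=
  -- Only values on the boundary torus matter. A gauge may be any function, so the jump of `arg` and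
  -- the arbitrary coordinates off the tube are harmless.
  K.arcTransport Φ (K.coord x).1 (Complex.arg (K.coord x).2)

theorem meridianGauge_bdryPoint (hΦ : IsTransport Φ) (z : Circle) (hz : Φ _ _ (K.mer z) = 1)
    (θ : ℝ) : K.meridianGauge Φ (K.bdryPoint z (Circle.exp θ)) = K.arcTransport Φ z θ := by
  have : K.coord (K.bdryPoint z (Circle.exp θ)) = (z, (Circle.exp θ : ℂ)) := K.coord_tube _
  rw [meridianGauge, this]
  obtain ⟨m, hm⟩ := Circle.exp_eq_exp.1 (Circle.exp_arg (Circle.exp θ))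
  simp only
  rw [hm]
  exact (K.arcTransport_periodic hΦ z hz).int_mul m θ

/-- After the gauge transformation, transport on the boundary torus ignores the meridional
coordinate. -/
theorem gauge_bdryPoint_eq (hΦ : IsTransport Φ) (hmer : ∀ z, Φ _ _ (K.mer z) = 1)
    (z u : C(I, Circle)) {a b c d : K.exterior} (p : Path a b) (q : Path c d)
    (hp : ∀ t, p t = K.bdryPoint (z t) (u t)) (hq : ∀ t, q t = K.bdryPoint (z t) 1) :
    K.meridianGauge Φ a * Φ a b (.mk p) * (K.meridianGauge Φ b)⁻¹ =
      K.meridianGauge Φ c * Φ c d (.mk q) * (K.meridianGauge Φ d)⁻¹ := by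
  obtain ⟨θ, hθ, -⟩ := Circle.isCoveringMap_exp.exists_path_lifts u (Complex.arg (u 0))
    (Circle.exp_arg _).symm
  have hθ' (t : I) : Circle.exp (θ t) = u t := congrFun hθ t
  obtain rfl : a = K.bdryPoint (z 0) (Circle.exp (θ 0)) := by rw [hθ', ← hp, p.source]
  obtain rfl : b = K.bdryPoint (z 1) (Circle.exp (θ 1)) := by rw [hθ', ← hp, p.target]
  obtain rfl : c = K.bdryPoint (z 0) 1 := by rw [← hq, q.source]
  obtain rfl : d = K.bdryPoint (z 1) 1 := by rw [← hq, q.target]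
  have hone (z : Circle) : K.meridianGauge Φ (K.bdryPoint z 1) = 1 := by
    have := K.meridianGauge_bdryPoint hΦ z (hmer z) 0
    rw [Circle.exp_zero] at this
    rw [this, arcTransport, Path.segment_same]
    exact hΦ.refl _
  let arc (z : Circle) (θ : ℝ) : Path (K.bdryPoint z 1) (K.bdryPoint z (Circle.exp θ)) :=
    ((Path.segment 0 θ).map ((K.meridianCircle z).comp Circle.exp).continuous).cast
      (by simp [meridianCircle]) (by simp [meridianCircle])
  have harc (z : Circle) (θ : ℝ) : Φ _ _ (.mk (arc z θ)) = K.arcTransport Φ z θ :=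
    Path.Homotopic.Quotient.apply_cast Φ (.mk ((Path.segment 0 θ).map
      ((K.meridianCircle z).comp Circle.exp).continuous)) _ _
  have harc' (z : Circle) (θ : ℝ) (t : I) :
      arc z θ t = K.bdryPoint z (Circle.exp ((t : ℝ) * θ)) := by
    change K.bdryPoint z (Circle.exp (AffineMap.lineMap 0 θ (t : ℝ))) = _
    simp [AffineMap.lineMap_apply]
  -- Shrinking the lifted angle `θ` to `0` sweeps out a square whose vertical sides are meridian
  -- arcs; the gauge records exactly the transport along these sides.
  have hsq := Path.Homotopic.square ⟨fun x : I × I => K.bdryPoint (z x.1)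
      (Circle.exp ((x.2 : ℝ) * θ x.1)), K.continuous_bdryPoint.comp (f := fun x : I × I =>
        (z x.1, Circle.exp ((x.2 : ℝ) * θ x.1))) (by fun_prop)⟩ q (arc (z 1) (θ 1))
    (arc (z 0) (θ 0)) p (by simp [hq])
    (fun t => harc' _ _ t) (fun t => harc' _ _ t)
    (by simp [hp, hθ'])
  have h := congrArg (Φ _ _) hsq
  rw [hΦ, hΦ, harc, harc, ← K.meridianGauge_bdryPoint hΦ _ (hmer _),
    ← K.meridianGauge_bdryPoint hΦ _ (hmer _)] at h
  rw [hone, hone, ← h]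
  simp

end TameKnot

namespace TameKnot

variable (K : TameKnot) {A : Type*} [CommGroup A]

/-- The open solid torus around the knot. -/
def openTorus : Set Sphere3 := K.tube '' {p | ‖p.2‖ < 1}

theorem isOpen_openTorus : IsOpen K.openTorus :=
  K.isOpen_tube_image (isOpen_lt (by fun_prop) continuous_const)

/-- Projection of the open solid torus to a longitude. -/
noncomputable def toLongitude (x : Sphere3) : K.exterior := K.bdryPoint (K.coord x).1 1

theorem continuousOn_toLongitude : ContinuousOn K.toLongitude K.openTorus :=
  K.continuous_bdryPoint.comp_continuousOn (f := fun x => ((K.coord x).1, (1 : Circle)))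
    ((continuous_fst.comp_continuousOn (K.continuousOn_coord.mono
      (image_subset_range _ _))).prodMk continuousOn_const)

/-- Near the knot, gauged transport may be computed on the longitude. -/
theorem alongSegment_retr_eq {Φ : ∀ x y : K.exterior, Path.Homotopic.Quotient x y → A}
    (hΦ : IsTransport Φ) (hmer : ∀ z, Φ _ _ (K.mer z) = 1) {V : Type*} [AddCommGroup V]
    [Module ℝ V] [TopologicalSpace V] [IsTopologicalAddGroup V] [ContinuousSMul ℝ V]
    {s : V → Sphere3} (hs : Continuous s) {C : Set V}
    (hC : C ⊆ s ⁻¹' K.coreᶜ ∩ s ⁻¹' K.openTorus) (hconv : Convex ℝ C) {x y : V} (hx : x ∈ C)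
    (hy : y ∈ C) :
    IsTransport.alongSegment (fun x y p => K.meridianGauge Φ x * Φ x y p *
        (K.meridianGauge Φ y)⁻¹) (K.retr ∘ s) x y =
      IsTransport.alongSegment (fun x y p => K.meridianGauge Φ x * Φ x y p *
        (K.meridianGauge Φ y)⁻¹) (K.toLongitude ∘ s) x y := by
  let Ψ := fun x y p => K.meridianGauge Φ x * Φ x y p * (K.meridianGauge Φ y)⁻¹
  have hR₁ : ContinuousOn (K.retr ∘ s) (s ⁻¹' K.coreᶜ) :=
    K.continuousOn_retr.comp hs.continuousOn fun x hx => hx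
  have hR₂ : ContinuousOn (K.toLongitude ∘ s) (s ⁻¹' K.openTorus) :=
    K.continuousOn_toLongitude.comp hs.continuousOn fun x hx => hx
  have hmem (t : I) : Path.segment x y t ∈ C := hconv.lineMap_mem hx hy t.2
  have hcoord (t : I) : ∃ p : Circle × ℂ, K.tube p = s (Path.segment x y t) ∧ p.2 ≠ 0 ∧
      ‖p.2‖ < 1 := by
    obtain ⟨h1, p, hp, h2⟩ := hC (hmem t)
    refine ⟨p, h2, fun h0 => h1 ?_, hp⟩
    rw [← h2]
    exact K.tube_mem_core.2 h0
  have hcc : Continuous fun t : I => K.coord (s (Path.segment x y t)) :=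
    K.continuousOn_coord.comp_continuous (by fun_prop) fun t =>
      image_subset_range _ _ (hC (hmem t)).2
  have e₁ (t : I) : K.retr (s (Path.segment x y t)) =
      K.bdryPoint (K.coord (s (Path.segment x y t))).1
        (K.coord (s (Path.segment x y t))).2.dir := by
    obtain ⟨p, hp, h0, h1⟩ := hcoord t
    rw [← hp, K.retr_tube h0 h1.le, coord_tube]
  let p : Path (K.retr (s x)) (K.retr (s y)) :=
    ⟨⟨fun t => K.retr (s (Path.segment x y t)), hR₁.comp_continuous (by fun_prop)
      fun t => (hC (hmem t)).1⟩, by simp, by simp⟩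
  let q : Path (K.toLongitude (s x)) (K.toLongitude (s y)) :=
    ⟨⟨fun t => K.toLongitude (s (Path.segment x y t)), hR₂.comp_continuous (by fun_prop)
      fun t => (hC (hmem t)).2⟩, by simp, by simp⟩
  have h := K.gauge_bdryPoint_eq hΦ hmer ⟨fun t => (K.coord (s (Path.segment x y t))).1,
    by fun_prop⟩ ⟨fun t => (K.coord (s (Path.segment x y t))).2.dir,
      Complex.continuousOn_dir.comp_continuous (by fun_prop) fun t => by
        obtain ⟨p, hp, h0, h1⟩ := hcoord t
        rwa [← hp, coord_tube]⟩ p q e₁ (fun t => rfl)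
  have hp := IsTransport.alongSegment_eq (Φ := Ψ) hconv (hR₁.mono fun z hz => (hC hz).1) p
    (Path.segment x y) (by fun_prop) hmem (fun t => rfl)
  have hq := IsTransport.alongSegment_eq (Φ := Ψ) hconv (hR₂.mono fun z hz => (hC hz).2) q
    (Path.segment x y) (by fun_prop) hmem (fun t => rfl)
  rw [Path.source, Path.target] at hp hq
  rw [← hp, ← hq]
  exact h

/-- A transport which is trivial on meridians is a coboundary. -/
theorem exists_potential {Φ : ∀ x y : K.exterior, Path.Homotopic.Quotient x y → A}
    (hΦ : IsTransport Φ) (hmer : ∀ z, Φ _ _ (K.mer z) = 1) :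
    ∃ l : K.exterior → A, ∀ (x y : K.exterior) (p : Path.Homotopic.Quotient x y),
      l y = l x * Φ x y p := by
  let Ψ := fun x y p => K.meridianGauge Φ x * Φ x y p * (K.meridianGauge Φ y)⁻¹
  have hΨ : IsTransport Ψ := hΦ.gauge _
  obtain ⟨s, ψ, hs, hψ, hsp, hψs, hsψ⟩ := Sphere3.exists_coordinates (K.tube (1, 0))
  have hne (x : K.exterior) : (x : Sphere3) ≠ K.tube (1, 0) := by
    intro h
    have h2 := x.2
    rw [h, tube_mem_ext, norm_zero] at h2
    linarith
  have hUW : ∀ x, x ∈ s ⁻¹' K.coreᶜ ∨ x ∈ s ⁻¹' K.openTorus := fun x => by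
    by_cases h : s x ∈ K.core
    · refine .inr (image_mono (fun p hp => ?_) h)
      simp [show p.2 = 0 from hp]
    · exact .inl h
  have hR₁ : ContinuousOn (K.retr ∘ s) (s ⁻¹' K.coreᶜ) :=
    K.continuousOn_retr.comp hs.continuousOn fun x hx => hx
  have hR₂ : ContinuousOn (K.toLongitude ∘ s) (s ⁻¹' K.openTorus) :=
    K.continuousOn_toLongitude.comp hs.continuousOn fun x hx => hx
  have hψe : Continuous fun x : K.exterior => ψ x := hψ.comp_continuous continuous_subtype_val hne
  have hcomp : IsCompact (range fun x : K.exterior => ψ x) := by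
    have := isCompact_iff_compactSpace.1 K.isClosed_exterior.isCompact
    exact isCompact_range hψe
  obtain ⟨a, b, hab⟩ := bddBelow_bddAbove_iff_subset_Icc.1
    ⟨hcomp.isBounded.bddBelow, hcomp.isBounded.bddAbove⟩
  have h₁₂ : ∀ C ⊆ s ⁻¹' K.coreᶜ ∩ s ⁻¹' K.openTorus, Convex ℝ C → ∀ x ∈ C, ∀ y ∈ C,
      IsTransport.alongSegment Ψ (K.retr ∘ s) x y =
        IsTransport.alongSegment Ψ (K.toLongitude ∘ s) x y :=
    fun C hC hconv x hx y hy => K.alongSegment_retr_eq hΦ hmer hs hC hconv hx hy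
  have h₁ : ∀ C ⊆ s ⁻¹' K.coreᶜ, Convex ℝ C → ∀ x ∈ C, ∀ y ∈ C, ∀ z ∈ C,
      IsTransport.alongSegment Ψ (K.retr ∘ s) x y * IsTransport.alongSegment Ψ (K.retr ∘ s) y z =
        IsTransport.alongSegment Ψ (K.retr ∘ s) x z :=
    fun C hC hconv x hx y hy z hz => hΨ.alongSegment_mul hconv (hR₁.mono hC) hx hy hz
  have h₂ : ∀ C ⊆ s ⁻¹' K.openTorus, Convex ℝ C → ∀ x ∈ C, ∀ y ∈ C, ∀ z ∈ C,
      IsTransport.alongSegment Ψ (K.toLongitude ∘ s) x y *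
        IsTransport.alongSegment Ψ (K.toLongitude ∘ s) y z =
        IsTransport.alongSegment Ψ (K.toLongitude ∘ s) x z :=
    fun C hC hconv x hx y hy z hz => hΨ.alongSegment_mul hconv (hR₂.mono hC) hx hy hz
  -- The local system is pulled back by the radial retraction off the knot and by the projection to
  -- the longitude inside the solid torus. The gauge makes these agree on the overlap.
  obtain ⟨σ', hσ, -⟩ := exists_isFlatOn_box (K.isOpen_compl_core.preimage hs)
    (K.isOpen_openTorus.preimage hs) hUW h₁ h₂ h₁₂ a b
  have hall {x y : K.exterior} (p : Path.Homotopic.Quotient x y) :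
      σ' (ψ y) = σ' (ψ x) * Ψ x y p := by
    refine Path.Homotopic.Quotient.forall_of_local
      (fun (x y : K.exterior) p => σ' (ψ y) = σ' (ψ x) * Ψ x y p) ?_ ?_ p
    · intro x y z p q hp hq
      rw [hq, hp, hΨ, mul_assoc]
    · intro x
      have hxU : ψ x ∈ s ⁻¹' K.coreᶜ := by
        rw [mem_preimage, hsψ _ (hne x)]
        exact K.exterior_subset x.2
      obtain ⟨ε, hε, hball⟩ := Metric.isOpen_iff.1 (K.isOpen_compl_core.preimage hs) _ hxU
      have hev := hσ (ψ x) (hab ⟨x, rfl⟩) hxU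
      have htend : Filter.Tendsto (fun y : K.exterior => ψ y) (𝓝 x) (𝓝[Icc a b] (ψ x)) :=
        tendsto_nhdsWithin_iff.2 ⟨hψe.continuousAt, .of_forall fun y => hab ⟨y, rfl⟩⟩
      refine ⟨_, Filter.inter_mem (htend.eventually hev)
        (hψe.continuousAt.preimage_mem_nhds (ball_mem_nhds _ hε)), fun y z p hp => ?_⟩
      have hy := hp 0
      have hz := hp 1
      rw [p.source] at hy
      rw [p.target] at hz
      have hy1 : σ' (ψ y) = _ := hy.1
      have hz1 : σ' (ψ z) = _ := hz.1
      have hpath := IsTransport.alongSegment_eq (Φ := Ψ) (convex_ball (ψ x) ε) (hR₁.mono hball) p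
        (fun t => ψ (p t)) (hψe.comp p.continuous) (fun t => (hp t).2) (fun t => by
          simp only [Function.comp_apply]
          rw [hsψ _ (hne _), K.retr_of_mem])
      simp only [p.source, p.target] at hpath
      rw [hpath, hz1, hy1, mul_assoc, hΨ.alongSegment_mul (convex_ball (ψ x) ε) (hR₁.mono hball)
        (mem_ball_self hε) hy.2 hz.2]
  -- The gauge is undone to pass from a potential of `Ψ` to one of `Φ`.
  refine ⟨fun x => σ' (ψ x) * K.meridianGauge Φ x, fun x y p => ?_⟩
  simp only [hall p, Ψ]
  rw [mul_assoc, inv_mul_cancel_right, mul_assoc]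

/-- The group of a knot is normally generated by the meridians, in the sense of characters. -/
theorem eq_one_of_meridian (χ : K.Group →* A) (hχ : ∀ m, K.IsMeridian m → χ m = 1) :
    χ = 1 := by
  obtain ⟨Φ, hΦ, hΦχ⟩ := IsTransport.exists_of_character K.basePoint χ
  have hmer (z : Circle) : Φ _ _ (K.mer z) = 1 := by
    rw [← hΦ.conjPath (.mk (K.longPath z)), hΦχ, K.conjPath_longPath]
    exact hχ _ K.isMeridian_mer₀
  obtain ⟨l, hl⟩ := K.exists_potential hΦ hmer
  ext g
  have h := hl _ _ g.toPath
  rw [left_eq_mul] at h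
  rw [← hΦχ]
  exact h

end TameKnot

/-! ### Dihedral groups and induced maps of orbifold groups. -/

/-- The elements of a group generated by two involutions are rotations or reflections. -/
theorem Subgroup.mem_closure_pair_involutions {G : Type*} [Group G] {a b x : G} (ha : a * a = 1)
    (hb : b * b = 1) (hx : x ∈ Subgroup.closure {a, b}) :
    ∃ k : ℤ, x = (a * b) ^ k ∨ x = (a * b) ^ k * a := by
  have ha' : a⁻¹ = a := inv_eq_of_mul_eq_one_right ha
  have hb' : b⁻¹ = b := inv_eq_of_mul_eq_one_right hb
  have hconj (k : ℤ) : a * (a * b) ^ k = (a * b) ^ (-k) * a := by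
    have h : a * (a * b) ^ k * a⁻¹ = (a * (a * b) * a⁻¹) ^ k := conj_zpow.symm
    have h2 : a * (a * b) * a⁻¹ = (a * b)⁻¹ := by
      rw [← mul_assoc a a b, ha, one_mul, mul_inv_rev, hb']
    rw [h2, inv_zpow, ← zpow_neg] at h
    rw [← h, inv_mul_cancel_right]
  have hba : b = a * (a * b) := by rw [← mul_assoc, ha, one_mul]
  have hA (y : G) : (∃ k : ℤ, y = (a * b) ^ k ∨ y = (a * b) ^ k * a) →
      ∃ k : ℤ, a * y = (a * b) ^ k ∨ a * y = (a * b) ^ k * a := by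
    rintro ⟨k, rfl | rfl⟩
    · exact ⟨-k, .inr (hconj k)⟩
    · exact ⟨-k, .inl (by rw [← mul_assoc, hconj, mul_assoc, ha, mul_one])⟩
  have hB (y : G) : (∃ k : ℤ, y = (a * b) ^ k ∨ y = (a * b) ^ k * a) →
      ∃ k : ℤ, b * y = (a * b) ^ k ∨ b * y = (a * b) ^ k * a := by
    rintro ⟨k, h⟩
    have := hA (a * b * y) ⟨k + 1, by
      rw [zpow_add_one, (Commute.zpow_self (a * b) k).eq]
      exact h.imp (fun h => by rw [h]) (fun h => by rw [h]; exact (mul_assoc _ _ _).symm)⟩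
    rwa [← mul_assoc a, ← hba] at this
  induction hx using Subgroup.closure_induction_left with
  | one => exact ⟨0, by simp⟩
  | mul_left y hy z hz ih =>
    rcases hy with rfl | rfl
    · exact hA _ ih
    · exact hB _ ih
  | inv_mul_cancel y hy z hz ih =>
    rcases hy with rfl | rfl
    · rw [ha']; exact hA _ ih
    · rw [hb']; exact hB _ ih

/-- A product of involutions from a pair that is detected by a sign character is an involution. -/
theorem MonoidHom.mul_self_eq_one_of_mem_closure_pair {G Q A : Type*} [Group G] [Group Q]
    [CommGroup A] (π : G →* Q) (χ : G →* A) {m₁ m₂ g : G} (h₁ : π m₁ * π m₁ = 1)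
    (h₂ : π m₂ * π m₂ = 1) {ζ : A} (hζ : ζ * ζ = 1) (hχ₁ : χ m₁ = ζ) (hχ₂ : χ m₂ = ζ)
    (hg : g ∈ Subgroup.closure {m₁, m₂}) (hχ : χ g ≠ 1) : π g * π g = 1 := by
  -- `χ` is not assumed to factor through `π`. The normal form is therefore taken in `Q × A`, where
  -- the images of `m₁` and `m₂` are still involutions and the sign remains visible.
  let F : G →* Q × A := π.prod χ
  have hF (x : G) : F x = (π x, χ x) := rfl
  have hm₁ : F m₁ * F m₁ = 1 := by simp [hF, h₁, hχ₁, hζ]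
  have hm₂ : F m₂ * F m₂ = 1 := by simp [hF, h₂, hχ₂, hζ]
  have hFg : F g ∈ Subgroup.closure {F m₁, F m₂} := by
    have := Subgroup.mem_map_of_mem F hg
    rwa [MonoidHom.map_closure, image_pair] at this
  obtain ⟨k, hk | hk⟩ := Subgroup.mem_closure_pair_involutions hm₁ hm₂ hFg
  -- A rotation has sign `(ζ * ζ) ^ k = 1`.
  · refine absurd ?_ hχ
    have := congrArg Prod.snd hk
    simpa [hF, hχ₁, hχ₂, hζ] using this
  · have h3 : F m₁ * (F m₁ * F m₂) ^ k * F m₁ = ((F m₁ * F m₂) ^ k)⁻¹ := by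
      have h4 : F m₁ * (F m₁ * F m₂) ^ k * (F m₁)⁻¹ = (F m₁ * (F m₁ * F m₂) * (F m₁)⁻¹) ^ k :=
        conj_zpow.symm
      have h5 : F m₁ * (F m₁ * F m₂) * (F m₁)⁻¹ = (F m₁ * F m₂)⁻¹ := by
        rw [← mul_assoc, hm₁, one_mul, mul_inv_rev, inv_eq_of_mul_eq_one_right hm₂]
      rw [h5, inv_zpow, inv_eq_of_mul_eq_one_right hm₁] at h4
      exact h4
    have h6 : F g * F g = 1 := by
      rw [hk, mul_assoc, ← mul_assoc (F m₁), h3, mul_inv_cancel]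
    exact congrArg Prod.fst h6

theorem MonoidHom.map_eq_one_iff_of_conj {G A : Type*} [Group G] [CommGroup A] (χ : G →* A)
    {x y c : G} (h : x = c⁻¹ * y * c ∨ x = c⁻¹ * y⁻¹ * c) : χ x = 1 ↔ χ y = 1 := by
  rcases h with rfl | rfl <;> simp

theorem MonoidHom.map_mul_self_eq_one_iff_of_conj {G Q : Type*} [Group G] [Group Q] (F : G →* Q)
    {x y c : G} (h : x = c⁻¹ * y * c ∨ x = c⁻¹ * y⁻¹ * c) : F x * F x = 1 ↔ F y * F y = 1 := by
  have key (z : G) : F (c⁻¹ * z * c) * F (c⁻¹ * z * c) = (F c)⁻¹ * (F z * F z) * F c := by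
    simp only [map_mul, map_inv]
    group
  have hc (q : Q) : (F c)⁻¹ * q * F c = 1 ↔ q = 1 := by
    rw [mul_eq_one_iff_eq_inv, inv_mul_eq_iff_eq_mul, mul_inv_cancel]
  rcases h with rfl | rfl <;> rw [key, hc]
  rw [map_inv, ← mul_inv_rev, inv_eq_one]

namespace TameKnot

variable {K K₁ K₂ : TameKnot}

theorem mk_meridian_mul_self {m : K.Group} (hm : K.IsMeridian m) :
    QuotientGroup.mk' K.squaresSubgroup m * QuotientGroup.mk' K.squaresSubgroup m = 1 := by
  rw [← map_mul, ← pow_two]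
  exact (QuotientGroup.eq_one_iff _).2 (Subgroup.subset_normalClosure ⟨m, hm, rfl⟩)

/-- The character of the meridians is determined by one meridian up to inversion. -/
theorem eq_one_of_isMeridian {A : Type*} [CommGroup A] (χ : K.Group →* A) {μ : K.Group}
    (hμ : K.IsMeridian μ) (h : χ μ = 1) : χ = 1 := by
  obtain ⟨c, hc⟩ := hμ.exists_conj
  refine K.eq_one_of_meridian χ fun m hm => ?_
  obtain ⟨d, hd⟩ := hm.exists_conj
  exact (χ.map_eq_one_iff_of_conj hd).2 ((χ.map_eq_one_iff_of_conj hc).1 h)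

/-- An epimorphism which sends the square of one meridian to the squares subgroup induces an
epimorphism of orbifold groups. -/
theorem inducesOrbEpi_of_sq_mem {φ : K₁.Group →* K₂.Group} (hφ : Function.Surjective φ)
    {μ : K₁.Group} (hμ : K₁.IsMeridian μ)
    (h : QuotientGroup.mk' K₂.squaresSubgroup (φ μ) * QuotientGroup.mk' K₂.squaresSubgroup (φ μ)
      = 1) : InducesOrbEpi φ := by
  let F : K₁.Group →* K₂.OrbGroup := (QuotientGroup.mk' K₂.squaresSubgroup).comp φ
  have hle : K₁.squaresSubgroup ≤ F.ker := by
    refine Subgroup.normalClosure_le_normal ?_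
    rintro _ ⟨m, hm, rfl⟩
    obtain ⟨c, hc⟩ := hμ.exists_conj
    obtain ⟨d, hd⟩ := hm.exists_conj
    rw [SetLike.mem_coe, MonoidHom.mem_ker, pow_two, map_mul]
    exact (F.map_mul_self_eq_one_iff_of_conj hd).2 ((F.map_mul_self_eq_one_iff_of_conj hc).1 h)
  refine ⟨QuotientGroup.lift _ F hle, ?_, fun g => rfl⟩
  exact QuotientGroup.lift_surjective_of_surjective _ F
    ((QuotientGroup.mk'_surjective _).comp hφ) hle

/-- The central argument: `φ μ` has nontrivial sign, so it is a reflection in a dihedral group. -/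
theorem inducesOrbEpi_of_mem_closure {φ : K₁.Group →* K₂.Group} (hφ : Function.Surjective φ)
    {μ : K₁.Group} (hμ : K₁.IsMeridian μ) {m₁ m₂ : K₂.Group} (h₁ : K₂.IsMeridian m₁)
    (h₂ : K₂.IsMeridian m₂) (h : φ μ ∈ Subgroup.closure {m₁, m₂}) : InducesOrbEpi φ := by
  obtain ⟨χ, hχ2, hχ⟩ := K₂.exists_linking_character
  refine inducesOrbEpi_of_sq_mem hφ hμ (MonoidHom.mul_self_eq_one_of_mem_closure_pair _ χ
    (mk_meridian_mul_self h₁) (mk_meridian_mul_self h₂) (ζ := Circle.exp Real.pi) ?_ (hχ _ h₁)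
    (hχ _ h₂) h fun h0 => ?_)
  · rw [← hχ _ h₁]
    exact hχ2 _
  -- If `χ (φ μ) = 1`, then `χ ∘ φ` is trivial; a preimage of `m₁` then gives `-1 = 1`.
  · have h1 := eq_one_of_isMeridian (χ.comp φ) hμ h0
    obtain ⟨g, hg⟩ := hφ m₁
    have h2 := DFunLike.congr_fun h1 g
    rw [MonoidHom.comp_apply, hg, hχ _ h₁] at h2
    have h3 := congrArg (fun u : Circle => (u : ℂ)) h2
    norm_num [Circle.coe_exp] at h3

theorem exists_meridians_of_complexity_le_two {g : K.Group} (h : K.meridionalComplexity g ≤ 2) :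
    ∃ m₁ m₂, K.IsMeridian m₁ ∧ K.IsMeridian m₂ ∧ g ∈ Subgroup.closure {m₁, m₂} := by
  classical
  -- A strict bound on the infimum provides an actual finite set of meridians; sets with fewer than
  -- two elements are padded by repetition.
  have h3 : K.meridionalComplexity g < 3 := lt_of_le_of_lt h (by norm_num)
  simp only [meridionalComplexity, iInf_lt_iff] at h3
  obtain ⟨S, ⟨hS, hg⟩, hcard⟩ := h3
  have hcard' : S.card ≤ 2 := by
    have : S.card < 3 := by exact_mod_cast hcard
    omega
  suffices ∃ m₁ m₂, K.IsMeridian m₁ ∧ K.IsMeridian m₂ ∧ (S : Set K.Group) ⊆ {m₁, m₂} by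
    obtain ⟨m₁, m₂, h₁, h₂, hsub⟩ := this
    exact ⟨m₁, m₂, h₁, h₂, Subgroup.closure_mono hsub hg⟩
  rcases S.eq_empty_or_nonempty with rfl | ⟨x, hx⟩
  · exact ⟨_, _, K.isMeridian_mer₀, K.isMeridian_mer₀, by simp⟩
  · rcases (S.erase x).eq_empty_or_nonempty with he | ⟨y, hy⟩
    · refine ⟨x, x, hS x hx, hS x hx, fun z hz => ?_⟩
      by_contra hne
      have : z ∈ S.erase x := Finset.mem_erase.2 ⟨fun h => hne (by simp [h]), hz⟩
      simp [he] at this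
    · refine ⟨x, y, hS x hx, hS y (Finset.mem_of_mem_erase hy), fun z hz => ?_⟩
      by_cases hzx : z = x
      · simp [hzx]
      · right
        have hc : (S.erase x).card ≤ 1 := by rw [Finset.card_erase_of_mem hx]; omega
        exact Finset.card_le_one.1 hc z (Finset.mem_erase.2 ⟨hzx, hz⟩) y hy

theorem inducesOrbEpi_of_complexity_le_two {φ : K₁.Group →* K₂.Group}
    (hφ : Function.Surjective φ) {μ : K₁.Group} (hμ : K₁.IsMeridian μ)
    (h : K₂.meridionalComplexity (φ μ) ≤ 2) : InducesOrbEpi φ := by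
  obtain ⟨m₁, m₂, h₁, h₂, hg⟩ := exists_meridians_of_complexity_le_two h
  exact inducesOrbEpi_of_mem_closure hφ hμ h₁ h₂ hg

end TameKnot

/-! ### Generators of the fundamental group of a twice punctured disc. -/

namespace FundamentalGroup

variable {X Y Z : Type*} [TopologicalSpace X] [TopologicalSpace Y] [TopologicalSpace Z]

/-- A subgroup of the fundamental group which contains all short paths, closed up by chosen paths
from the base point, is everything. -/
theorem subgroup_eq_top_of_local {x₀ : X} (H : Subgroup (FundamentalGroup X x₀))
    (p : ∀ x, Path.Homotopic.Quotient x₀ x)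
    (hloc : ∀ x, ∃ N ∈ 𝓝 x, ∀ y z (q : Path y z), (∀ t, q t ∈ N) →
      fromPath (((p y).trans (.mk q)).trans (p z).symm) ∈ H) : H = ⊤ := by
  have hall {x y : X} (q : Path.Homotopic.Quotient x y) :
      fromPath (((p x).trans q).trans (p y).symm) ∈ H := by
    refine Path.Homotopic.Quotient.forall_of_local
      (fun x y q => fromPath (((p x).trans q).trans (p y).symm) ∈ H) ?_ hloc q
    intro x y z q r hq hr
    have := H.mul_mem hr hq
    rw [mul_def] at this
    simp only [Path.Homotopic.Quotient.trans_assoc] at this ⊢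
    rwa [← Path.Homotopic.Quotient.trans_assoc (p y).symm, Path.Homotopic.Quotient.symm_trans,
      Path.Homotopic.Quotient.refl_trans] at this
  rw [eq_top_iff]
  intro g _
  obtain ⟨g', rfl⟩ := conjPath_surjective (p x₀) g
  exact hall g'.toPath

/-- The generation half of van Kampen's theorem: the path from `x₀` to `x` is chosen inside every
piece that contains `x`, so closing up a short path never leaves its piece. -/
theorem subgroup_eq_top_of_cover {x₀ : X} {U₁ U₂ : Set X} (h₁ : IsOpen U₁) (h₂ : IsOpen U₂)
    (hcov : ∀ x, x ∈ U₁ ∨ x ∈ U₂) (hj₁ : ∀ x ∈ U₁, JoinedIn U₁ x₀ x)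
    (hj₂ : ∀ x ∈ U₂, JoinedIn U₂ x₀ x) (hj₁₂ : ∀ x ∈ U₁ ∩ U₂, JoinedIn (U₁ ∩ U₂) x₀ x)
    (H : Subgroup (FundamentalGroup X x₀))
    (hH : ∀ p : Path x₀ x₀, ((∀ t, p t ∈ U₁) ∨ ∀ t, p t ∈ U₂) → fromPath (.mk p) ∈ H) :
    H = ⊤ := by
  have hp (x : X) : ∃ p : Path x₀ x, (x ∈ U₁ → ∀ t, p t ∈ U₁) ∧ (x ∈ U₂ → ∀ t, p t ∈ U₂) := by
    by_cases hx₁ : x ∈ U₁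
    · by_cases hx₂ : x ∈ U₂
      · obtain ⟨p, hp⟩ := hj₁₂ x ⟨hx₁, hx₂⟩
        exact ⟨p, fun _ t => (hp t).1, fun _ t => (hp t).2⟩
      · obtain ⟨p, hp⟩ := hj₁ x hx₁
        exact ⟨p, fun _ => hp, fun h => absurd h hx₂⟩
    · obtain ⟨p, hp⟩ := hj₂ x ((hcov x).resolve_left hx₁)
      exact ⟨p, fun h => absurd h hx₁, fun _ => hp⟩
  choose p hp₁ hp₂ using hp
  have key (U : Set X) (hpU : ∀ x ∈ U, ∀ t, p x t ∈ U)
      (hU : ∀ p : Path x₀ x₀, (∀ t, p t ∈ U) → fromPath (.mk p) ∈ H) (y z : X) (q : Path y z)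
      (hq : ∀ t, q t ∈ U) :
      fromPath (((Path.Homotopic.Quotient.mk (p y)).trans (.mk q)).trans
        (Path.Homotopic.Quotient.mk (p z)).symm) ∈ H := by
    refine hU (((p y).trans q).trans (p z).symm) fun t => ?_
    have hy : y ∈ U := by simpa using hq 0
    have hz : z ∈ U := by simpa using hq 1
    have hr : range (((p y).trans q).trans (p z).symm) ⊆ U := by
      rw [Path.trans_range, Path.trans_range, Path.symm_range, union_subset_iff,
        union_subset_iff]
      exact ⟨⟨range_subset_iff.2 (hpU y hy), range_subset_iff.2 hq⟩,
        range_subset_iff.2 (hpU z hz)⟩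
    exact hr (mem_range_self t)
  refine subgroup_eq_top_of_local H (fun x => .mk (p x)) fun x => ?_
  rcases hcov x with hx | hx
  · exact ⟨U₁, h₁.mem_nhds hx, key U₁ (fun x hx t => hp₁ x hx t) fun p hp => hH p (.inl hp)⟩
  · exact ⟨U₂, h₂.mem_nhds hx, key U₂ (fun x hx t => hp₂ x hx t) fun p hp => hH p (.inr hp)⟩

/-- The standard generator of the fundamental group of the circle. -/
noncomputable def circleGen : FundamentalGroup Circle 1 := fromPath (.mk Circle.stdLoop)

/-- A path in the circle. -/
noncomputable def _root_.Circle.pathToOne (u : Circle) : Path u 1 where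
  toFun t := Circle.exp ((1 - (t : ℝ)) * Complex.arg u)
  source' := by simp [Circle.exp_arg]
  target' := by simp

/-- A map homotopic to one factoring through the circle has cyclic image on the fundamental
group. -/
theorem exists_conjPath_zpowers {f : C(Y, Z)} {d : C(Y, Circle)} {J : C(Circle, Z)}
    (F : f.Homotopy (J.comp d)) (y : Y) : ∃ c : Path.Homotopic.Quotient (f y) (J 1),
      ∀ γ, map f y γ ∈ Subgroup.zpowers (conjPath c (map J 1 circleGen)) := by
  let e : Path.Homotopic.Quotient (d y) 1 := .mk (Circle.pathToOne (d y))
  refine ⟨(Path.Homotopic.Quotient.mk (F.evalAt y)).trans (e.map J), fun γ => ?_⟩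
  rw [F.map_eq_conjPath, map_comp_apply]
  obtain ⟨δ, hδ⟩ := conjPath_surjective e (map d y γ)
  obtain ⟨n, hn⟩ := Circle.zpowers_stdLoop δ
  refine ⟨n, ?_⟩
  simp only at hn ⊢
  rw [← hδ, map_conjPath, ← hn, ← conjPath_conjPath, map_zpow, map_zpow, map_zpow]
  rfl

theorem map_id_apply (x : X) (γ : FundamentalGroup X x) : map (.id X) x γ = γ := by
  induction γ using Path.Homotopic.Quotient.ind with
  | mk γ => exact congrArg Path.Homotopic.Quotient.mk γ.map_id

end FundamentalGroup

section Punctured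

/-- The radial homotopy from a punctured convex set to a circle around the puncture. -/
theorem Convex.radial_mem {C : Set ℂ} (hC : Convex ℝ C) {q : ℂ} {r : ℝ} (hr : 0 < r)
    (hsub : sphere q r ⊆ C) {y : ℂ} (hy : y ∈ C \ {q}) (t : I) :
    (1 - (t : ℝ)) • y + (t : ℝ) • (q + r * ((y - q).dir : ℂ)) ∈ C \ {q} := by
  have hne : y - q ≠ 0 := sub_ne_zero.2 hy.2
  refine ⟨hC hy.1 (hsub ?_) (by linarith [t.2.2]) t.2.1 (by ring), ?_⟩
  · rw [mem_sphere_iff_norm, add_sub_cancel_left, norm_mul, Circle.norm_coe, mul_one,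
      Complex.norm_real, Real.norm_eq_abs, abs_of_pos hr]
  -- The point moves along the ray from `q` through `y`, at the positive distance `(1 - t)‖y - q‖ +
  -- t r` from `q`.
  · have h1 : (1 - (t : ℝ)) • y + (t : ℝ) • (q + r * ((y - q).dir : ℂ)) - q =
        (((1 - (t : ℝ)) * ‖y - q‖ + t * r : ℝ) : ℂ) * ((y - q).dir : ℂ) := by
      have h2 : y = q + ‖y - q‖ * ((y - q).dir : ℂ) := by
        have : (‖y - q‖ : ℂ) ≠ 0 := by simpa using hne
        rw [Complex.coe_dir hne]
        field_simp
        ring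
      simp only [Complex.real_smul]
      push_cast
      linear_combination (1 - (t : ℂ)) * h2
    have h3 : 0 < (1 - (t : ℝ)) * ‖y - q‖ + t * r := by
      have hn := norm_pos_iff.2 hne
      rcases t.2.1.eq_or_lt with h0 | h0
      · rw [← h0]; simpa using hne
      · have := mul_pos h0 hr
        have := mul_nonneg (sub_nonneg.2 t.2.2) hn.le
        linarith
    intro h4
    rw [mem_singleton_iff] at h4
    rw [h4, sub_self] at h1
    have := mul_ne_zero (Complex.ofReal_ne_zero.2 h3.ne') (y - q).dir.coe_ne_zero
    exact this h1.symm

/-- The fundamental group of a punctured convex set is generated by a circle around the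
puncture. -/
theorem Convex.punctured_fundamentalGroup {M : Type*} [TopologicalSpace M] {C : Set ℂ}
    (hC : Convex ℝ C) {q : ℂ} {r : ℝ} (hr : 0 < r) (hsub : sphere q r ⊆ C)
    (f : C(↥(C \ {q}), M)) (J : C(Circle, M))
    (hJ : ∀ u : Circle, ∀ h, J u = f ⟨q + r * u, h⟩) (y : ↥(C \ {q})) :
    ∃ c : Path.Homotopic.Quotient (f y) (J 1), ∀ γ, FundamentalGroup.map f y γ ∈
      Subgroup.zpowers (FundamentalGroup.conjPath c
        (FundamentalGroup.map J 1 FundamentalGroup.circleGen)) := by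
  have hne (y : ↥(C \ {q})) : (y : ℂ) - q ≠ 0 := sub_ne_zero.2 y.2.2
  have hd : Continuous fun y : ↥(C \ {q}) => ((y : ℂ) - q).dir :=
    Complex.continuousOn_dir.comp_continuous (by fun_prop) hne
  let d : C(↥(C \ {q}), Circle) := ⟨_, hd⟩
  let F : f.Homotopy (J.comp d) :=
    ⟨⟨fun x => f ⟨_, hC.radial_mem hr hsub x.2.2 x.1⟩, f.continuous.comp
      (Continuous.subtype_mk (by
        have := hd.comp (continuous_snd : Continuous (Prod.snd : I × ↥(C \ {q}) → _))
        have h2 := Circle.isEmbedding_coe.continuous.comp this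
        simp only [Function.comp_def] at h2
        fun_prop) _)⟩, fun y => ?_, fun y => ?_⟩
  · exact FundamentalGroup.exists_conjPath_zpowers F y
  · simp
  · rw [ContinuousMap.comp_apply, hJ (d y) (by simpa [d] using hC.radial_mem hr hsub y.2 1)]
    simp [d]

theorem Convex.punctured_joined {C : Set ℂ} (hC : Convex ℝ C) {q : ℂ} {r : ℝ} (hr : 0 < r)
    (hsub : sphere q r ⊆ C) {x y : ℂ} (hx : x ∈ C \ {q}) (hy : y ∈ C \ {q}) :
    JoinedIn (C \ {q}) x y := by
  have hcirc (u : Circle) : q + r * (u : ℂ) ∈ C \ {q} := by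
    refine ⟨hsub ?_, ?_⟩
    · rw [mem_sphere_iff_norm, add_sub_cancel_left, norm_mul, Circle.norm_coe, mul_one,
        Complex.norm_real, Real.norm_eq_abs, abs_of_pos hr]
    · simp [hr.ne']
  have key {x : ℂ} (hx : x ∈ C \ {q}) : JoinedIn (C \ {q}) x (q + r * (1 : Circle)) := by
    refine JoinedIn.trans (y := q + r * ((x - q).dir : ℂ))
      ⟨⟨⟨fun t => (1 - (t : ℝ)) • x + (t : ℝ) • (q + r * ((x - q).dir : ℂ)), by fun_prop⟩,
        by simp, by simp⟩, fun t => hC.radial_mem hr hsub hx t⟩ ?_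
    let p := Circle.pathToOne (x - q).dir
    have hp := Circle.isEmbedding_coe.continuous.comp p.continuous
    simp only [Function.comp_def] at hp
    exact ⟨⟨⟨fun t => q + r * (p t : ℂ), by fun_prop⟩, by simp, by simp⟩, fun t => hcirc _⟩
  exact (key hx).trans (key hy).symm

end Punctured

section Punctured

variable {M : Set ℂ} {C : Set ℂ} {q : ℂ} {r : ℝ}

theorem Convex.joinedIn_of_punctured (hC : Convex ℝ C) (hr : 0 < r) (hsub : sphere q r ⊆ C)
    (hM : M ∩ C = C \ {q}) {x y : M} (hx : (x : ℂ) ∈ C) (hy : (y : ℂ) ∈ C) :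
    JoinedIn {x : M | (x : ℂ) ∈ C} x y := by
  have hx' : (x : ℂ) ∈ C \ {q} := hM ▸ ⟨x.2, hx⟩
  have hy' : (y : ℂ) ∈ C \ {q} := hM ▸ ⟨y.2, hy⟩
  obtain ⟨p, hp⟩ := hC.punctured_joined hr hsub hx' hy'
  have hp' (t : I) : p t ∈ M ∩ C := hM ▸ hp t
  exact ⟨⟨⟨fun t => ⟨p t, (hp' t).1⟩, by fun_prop⟩, by simp, by simp⟩, fun t => (hp' t).2⟩

/-- The version for a space `M` with several punctures, only one of which lies in `C`. -/
theorem Convex.exists_generator_of_punctured (hC : Convex ℝ C) (hr : 0 < r)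
    (hsub : sphere q r ⊆ C) (hM : M ∩ C = C \ {q}) (J : C(Circle, M))
    (hJ : ∀ u, (J u : ℂ) = q + r * u) {y : M} (hy : (y : ℂ) ∈ C) :
    ∃ c : Path.Homotopic.Quotient y (J 1), ∀ p : Path y y, (∀ t, (p t : ℂ) ∈ C) →
      FundamentalGroup.fromPath (.mk p) ∈ Subgroup.zpowers (FundamentalGroup.conjPath c
        (FundamentalGroup.map J 1 FundamentalGroup.circleGen)) := by
  have hsubM : C \ {q} ⊆ M := hM ▸ inter_subset_left
  let f : C(↥(C \ {q}), M) := ⟨fun x => ⟨x, hsubM x.2⟩, by fun_prop⟩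
  have hy' : (y : ℂ) ∈ C \ {q} := hM ▸ ⟨y.2, hy⟩
  obtain ⟨c, hc⟩ := hC.punctured_fundamentalGroup hr hsub f J
    (fun u h => Subtype.ext (hJ u)) ⟨y, hy'⟩
  refine ⟨c, fun p hp => ?_⟩
  have hp' (t : I) : (p t : ℂ) ∈ C \ {q} := hM ▸ ⟨(p t).2, hp t⟩
  exact hc (FundamentalGroup.fromPath (.mk ⟨⟨fun t => ⟨p t, hp' t⟩, by fun_prop⟩, by simp, by simp⟩))

end Punctured

/-- The closed unit disc without the points of `Q`. -/
def puncturedDisc (Q : Finset ℂ) : Set ℂ := {z | ‖z‖ ≤ 1 ∧ z ∉ Q}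

theorem nhds_halfDisc {L : ℂ →L[ℝ] ℝ} {q : ℂ} (hq : ‖q‖ < 1) {c : ℝ} (h : L q < c) :
    ∃ ε > 0, ∀ r < ε, sphere q r ⊆ closedBall 0 1 ∩ {z | L z < c} := by
  have hmem : ball (0 : ℂ) 1 ∩ {z | L z < c} ∈ 𝓝 q :=
    (isOpen_ball.inter (isOpen_lt L.continuous continuous_const)).mem_nhds ⟨by simpa using hq, h⟩
  obtain ⟨ε, hε, hsub⟩ := Metric.mem_nhds_iff.1 hmem
  refine ⟨ε, hε, fun r hr z hz => ?_⟩
  have := hsub (show z ∈ ball q ε by rw [mem_ball, mem_sphere.1 hz]; exact hr)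
  exact ⟨ball_subset_closedBall this.1, this.2⟩

theorem exists_separating_functional {q₁ q₂ : ℂ} (hne : q₁ ≠ q₂) :
    ∃ L : ℂ →L[ℝ] ℝ, L q₁ < L q₂ := by
  have hv : q₂ - q₁ ≠ 0 := sub_ne_zero.2 hne.symm
  by_cases h : (q₂ - q₁).re = 0
  · have him : (q₂ - q₁).im ≠ 0 := fun h' => hv (Complex.ext h h')
    rw [Complex.sub_im, sub_ne_zero] at him
    rcases lt_or_gt_of_ne him with h1 | h1
    · exact ⟨-Complex.imCLM, by simpa using h1⟩
    · exact ⟨Complex.imCLM, by simpa using h1⟩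
  · rw [Complex.sub_re, sub_eq_zero] at h
    rcases lt_or_gt_of_ne h with h1 | h1
    · exact ⟨-Complex.reCLM, by simpa using h1⟩
    · exact ⟨Complex.reCLM, by simpa using h1⟩

theorem puncturedDisc_pair_inter {L : ℂ →L[ℝ] ℝ} {q₁ q₂ : ℂ} {c : ℝ} (h₂ : c ≤ L q₂) :
    puncturedDisc {q₁, q₂} ∩ (closedBall 0 1 ∩ {z | L z < c}) =
      (closedBall 0 1 ∩ {z | L z < c}) \ {q₁} := by
  ext z
  simp only [puncturedDisc, Finset.mem_insert, Finset.mem_singleton, mem_inter_iff, mem_ofPred_eq,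
    mem_closedBall_zero_iff, mem_sdiff, mem_singleton_iff]
  refine ⟨fun h => ⟨h.2, fun h' => h.1.2 (.inl h')⟩, fun h => ⟨⟨h.1.1, ?_⟩, h.1⟩⟩
  rintro (h' | rfl)
  · exact h.2 h'
  · exact absurd h.1.2 (not_lt.2 h₂)

/-- The fundamental group of a disc with two punctures is generated by small circles around the
punctures. -/
theorem puncturedDisc_fundamentalGroup {q₁ q₂ : ℂ} (h₁ : ‖q₁‖ < 1) (h₂ : ‖q₂‖ < 1)
    (hne : q₁ ≠ q₂) : ∃ r₀ > (0 : ℝ), ∀ r : ℝ, 0 < r → r < r₀ → ∀ J₁ J₂ : C(Circle, puncturedDisc {q₁, q₂}),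
      (∀ u, (J₁ u : ℂ) = q₁ + r * u) → (∀ u, (J₂ u : ℂ) = q₂ + r * u) →
      ∃ (y : puncturedDisc {q₁, q₂}) (c₁ : Path.Homotopic.Quotient y (J₁ 1))
        (c₂ : Path.Homotopic.Quotient y (J₂ 1)), (∀ x, Joined y x) ∧ Subgroup.closure
        {FundamentalGroup.conjPath c₁ (FundamentalGroup.map J₁ 1 FundamentalGroup.circleGen),
          FundamentalGroup.conjPath c₂ (FundamentalGroup.map J₂ 1 FundamentalGroup.circleGen)} =
        ⊤ := by
  obtain ⟨L, hL⟩ := exists_separating_functional hne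
  let M : Set ℂ := puncturedDisc {q₁, q₂}
  -- With `m` the midpoint, `L q₁ = m - 2η` and `L q₂ = m + 2η`. The half discs `C₁` and `C₂`
  -- contain one puncture each and overlap in a convex strip without punctures.
  let η := (L q₂ - L q₁) / 4
  let m := (L q₁ + L q₂) / 2
  have hη : 0 < η := by simp only [η]; linarith
  let C₁ : Set ℂ := closedBall 0 1 ∩ {z | L z < m + η}
  let C₂ : Set ℂ := closedBall 0 1 ∩ {z | (-L) z < -m + η}
  have hC₁ : Convex ℝ C₁ := (convex_closedBall _ _).inter (convex_halfSpace_lt L.isLinear _)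
  have hC₂ : Convex ℝ C₂ := (convex_closedBall _ _).inter (convex_halfSpace_lt (-L).isLinear _)
  have hM₁ : M ∩ C₁ = C₁ \ {q₁} := puncturedDisc_pair_inter (by simp only [m, η]; linarith)
  have hM₂ : M ∩ C₂ = C₂ \ {q₂} := by
    have : M = puncturedDisc {q₂, q₁} := by rw [Finset.pair_comm]
    rw [this]
    exact puncturedDisc_pair_inter (by
      simp only [m, η, neg_apply]; linarith)
  obtain ⟨ε₁, hε₁, hs₁⟩ := nhds_halfDisc (L := L) h₁ (c := m + η) (by simp only [m, η]; linarith)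
  obtain ⟨ε₂, hε₂, hs₂⟩ := nhds_halfDisc (L := -L) h₂ (c := -m + η) (by
    simp only [m, η, neg_apply]; linarith)
  refine ⟨min ε₁ ε₂, lt_min hε₁ hε₂, fun r hr hr' J₁ J₂ hJ₁ hJ₂ => ?_⟩
  have hsub₁ : sphere q₁ r ⊆ C₁ := hs₁ r (hr'.trans_le (min_le_left _ _))
  have hsub₂ : sphere q₂ r ⊆ C₂ := hs₂ r (hr'.trans_le (min_le_right _ _))
  have hCM {z : ℂ} (hz : z ∈ C₁ ∩ C₂) : z ∈ M := by
    by_cases h : z = q₁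
    · have : z ∈ M ∩ C₂ := hM₂ ▸ ⟨hz.2, by rw [h]; exact hne⟩
      exact this.1
    · have : z ∈ M ∩ C₁ := hM₁ ▸ ⟨hz.1, h⟩
      exact this.1
  let z₀ : ℂ := (1 / 2 : ℝ) • q₁ + (1 / 2 : ℝ) • q₂
  have hz₀b : z₀ ∈ closedBall (0 : ℂ) 1 := (convex_closedBall (0 : ℂ) 1)
    (by simpa using h₁.le) (by simpa using h₂.le) (by norm_num) (by norm_num) (by norm_num)
  have hLz₀ : L z₀ = m := by
    simp only [z₀, map_add, map_smul, smul_eq_mul, m]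
    ring
  have hz₀ : z₀ ∈ C₁ ∩ C₂ := ⟨⟨hz₀b, by simp [hLz₀, hη]⟩, hz₀b, by simp [hLz₀, hη]⟩
  let y : M := ⟨z₀, hCM hz₀⟩
  obtain ⟨c₁, hc₁⟩ := hC₁.exists_generator_of_punctured hr hsub₁ hM₁ J₁ hJ₁ (y := y) hz₀.1
  obtain ⟨c₂, hc₂⟩ := hC₂.exists_generator_of_punctured hr hsub₂ hM₂ J₂ hJ₂ (y := y) hz₀.2
  have hj₁ (x : M) (hx : (x : ℂ) ∈ C₁) : JoinedIn {x : M | (x : ℂ) ∈ C₁} y x :=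
    hC₁.joinedIn_of_punctured hr hsub₁ hM₁ hz₀.1 hx
  have hj₂ (x : M) (hx : (x : ℂ) ∈ C₂) : JoinedIn {x : M | (x : ℂ) ∈ C₂} y x :=
    hC₂.joinedIn_of_punctured hr hsub₂ hM₂ hz₀.2 hx
  have hcov (x : M) : (x : ℂ) ∈ C₁ ∨ (x : ℂ) ∈ C₂ := by
    have hxb : (x : ℂ) ∈ closedBall (0 : ℂ) 1 := by simpa using x.2.1
    by_cases h : L x < m + η
    · exact .inl ⟨hxb, h⟩
    · refine .inr ⟨hxb, ?_⟩
      simp only [mem_ofPred_eq, neg_apply]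
      linarith
  have hopen (L : ℂ →L[ℝ] ℝ) (c : ℝ) :
      IsOpen {x : M | (x : ℂ) ∈ closedBall (0 : ℂ) 1 ∩ {z | L z < c}} := by
    have : {x : M | (x : ℂ) ∈ closedBall (0 : ℂ) 1 ∩ {z | L z < c}} = {x : M | L x < c} := by
      ext x
      have : ‖(x : ℂ)‖ ≤ 1 := x.2.1
      simp [this]
    rw [this]
    exact isOpen_lt (by fun_prop) continuous_const
  refine ⟨y, c₁, c₂, fun x => ?_, ?_⟩
  · rcases hcov x with hx | hx
    · exact (hj₁ x hx).joined
    · exact (hj₂ x hx).joined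
  · refine FundamentalGroup.subgroup_eq_top_of_cover (hopen L (m + η)) (hopen (-L) (-m + η)) hcov
      hj₁ hj₂ (fun x hx => ?_) _ (fun p hp => ?_)
    · have hmem (t : I) := (hC₁.inter hC₂).lineMap_mem hz₀ ⟨hx.1, hx.2⟩ t.2
      exact ⟨⟨⟨fun t => ⟨Path.segment z₀ x t, hCM (hmem t)⟩, by fun_prop⟩, by simp [y], by simp⟩,
        fun t => hmem t⟩
    · rcases hp with hp | hp
      · exact (Subgroup.zpowers_le.2 (Subgroup.subset_closure (by simp))) (hc₁ p hp)
      · exact (Subgroup.zpowers_le.2 (Subgroup.subset_closure (by simp))) (hc₂ p hp)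

/-- A locally convex subset of a normed space is locally path connected. -/
theorem locallyPathConnectedSpace_of_convex_inter_ball {E : Type*} [NormedAddCommGroup E]
    [NormedSpace ℝ E] {s : Set E} (h : ∀ x ∈ s, ∃ ε > 0, Convex ℝ (s ∩ ball x ε)) :
    LocallyPathConnectedSpace s := by
  choose! ε hε hc using h
  refine LocallyPathConnectedSpace.of_bases (fun x : s => nhds_basis_ball.restrict
    (q := fun δ => δ ≤ ε x) fun δ hδ => ⟨min δ (ε x), lt_min hδ (hε x x.2), min_le_right _ _,
      ball_subset_ball (min_le_left _ _)⟩) fun x δ hδ => ?_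
  rw [Topology.IsInducing.subtypeVal.isPathConnected_iff]
  have e : Subtype.val '' ball x δ = (s ∩ ball (x : E) (ε x)) ∩ ball (x : E) δ := by
    ext y
    constructor
    · rintro ⟨z, hz, rfl⟩
      exact ⟨⟨z.2, ball_subset_ball hδ.2 hz⟩, hz⟩
    · rintro ⟨⟨h1, -⟩, h2⟩
      exact ⟨⟨y, h1⟩, h2, rfl⟩
  rw [e]
  exact ((hc x x.2).inter (convex_ball _ _)).isPathConnected
    ⟨x, ⟨x.2, mem_ball_self (hε x x.2)⟩, mem_ball_self hδ.1⟩

instance unitInterval.instLocallyPathConnectedSpace : LocallyPathConnectedSpace I :=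
  locallyPathConnectedSpace_of_convex_inter_ball fun _ _ =>
    ⟨1, one_pos, (convex_Icc 0 1).inter (convex_ball _ _)⟩

instance puncturedDisc.instLocallyPathConnectedSpace (Q : Finset ℂ) :
    LocallyPathConnectedSpace (puncturedDisc Q) := by
  refine locallyPathConnectedSpace_of_convex_inter_ball fun x hx => ?_
  obtain ⟨ε, hε, hsub⟩ := Metric.isOpen_iff.1 Q.finite_toSet.isClosed.isOpen_compl x
    (show x ∈ (Q : Set ℂ)ᶜ from hx.2)
  have e : puncturedDisc Q ∩ ball x ε = closedBall 0 1 ∩ ball x ε := by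
    ext z
    simp only [puncturedDisc, mem_inter_iff, mem_ofPred_eq, mem_closedBall_zero_iff]
    exact ⟨fun h => ⟨h.1.1, h.2⟩, fun h => ⟨⟨h.1, hsub h.2⟩, h.2⟩⟩
  exact ⟨ε, hε, e ▸ (convex_closedBall 0 1).inter (convex_ball x ε)⟩

/-! ### Gluing a product with the interval onto a space. -/

namespace FundamentalGroup

variable {X Y M : Type*} [TopologicalSpace X] [TopologicalSpace Y] [TopologicalSpace M]

/-- Points of a closed subspace near `x` can be joined to `x` by short paths in the subspace. -/
theorem exists_nhds_short_path [LocallyPathConnectedSpace Y] {j : C(Y, X)} (hj : IsEmbedding j)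
    (hc : IsClosed (range j)) {x : X} {N : Set X} (hN : N ∈ 𝓝 x) :
    ∃ N₀ ∈ 𝓝 x, ∀ u, j u ∈ N₀ → ∃ (v : Y) (γ : Path u v), j v = x ∧ ∀ t, j (γ t) ∈ N := by
  by_cases hx : x ∈ range j
  · obtain ⟨v, rfl⟩ := hx
    obtain ⟨W, ⟨hW, hWc⟩, hWN⟩ := (path_connected_basis v).mem_iff.1
      (j.continuous.continuousAt.preimage_mem_nhds hN)
    rw [hj.isInducing.nhds_eq_comap, Filter.mem_comap] at hW
    obtain ⟨N₀, hN₀, hsub⟩ := hW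
    refine ⟨N₀, hN₀, fun u hu => ?_⟩
    obtain ⟨γ, hγ⟩ := hWc.joinedIn u (hsub hu) v
      (hsub (show j v ∈ N₀ from mem_of_mem_nhds hN₀))
    exact ⟨v, γ, rfl, fun t => hWN (hγ t)⟩
  · exact ⟨(range j)ᶜ, hc.isOpen_compl.mem_nhds hx, fun u hu => absurd (mem_range_self u) hu⟩

/-- The vertical path over `z` in a product with the interval. -/
def _root_.Path.vert (z : M) (t : I) : Path (z, (0 : I)) (z, t) where
  toFun s := (z, s * t)
  source' := by simp
  target' := by simp

/-- If a space is the union of a subspace `Y` and a product `M × I` glued along both ends and part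
of the sides, then its fundamental group is generated by loops in `Y`. -/
theorem map_surjective_of_union_prod [PathConnectedSpace Y] [LocallyPathConnectedSpace Y]
    [PathConnectedSpace M] [LocallyPathConnectedSpace M] {j₁ : C(Y, X)} (h₁ : IsEmbedding j₁)
    {j₂ : C(M × I, X)} (h₂ : IsEmbedding j₂) (hc₁ : IsClosed (range j₁))
    (hc₂ : IsClosed (range j₂)) (hcov : ∀ x, x ∈ range j₁ ∨ x ∈ range j₂) {B : Set M}
    (hB : B.Nonempty) (hS : ∀ z t, j₂ (z, t) ∈ range j₁ ↔ z ∈ B ∨ t = 0 ∨ t = 1)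
    (hX : ∀ x : X, ∃ N ∈ 𝓝 x, ∀ a b (p q : Path a b), (∀ t, p t ∈ N) → (∀ t, q t ∈ N) →
      Path.Homotopic.Quotient.mk p = .mk q) (y₀ : Y) :
    (∀ x, Nonempty (Path.Homotopic.Quotient (j₁ y₀) x)) ∧ Function.Surjective (map j₁ y₀) := by
  let vert (z : M) (t : I) : Path.Homotopic.Quotient (j₂ (z, 0)) (j₂ (z, t)) :=
    .mk ((Path.vert z t).map j₂.continuous)
  have hq₁ (x : X) : ∃ p : x ∈ range j₁ → Path.Homotopic.Quotient (j₁ y₀) x,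
      ∀ (h : x ∈ range j₁) (y : Y) (hy : j₁ y = x), ∃ γ : Path.Homotopic.Quotient y₀ y,
        p h = (γ.map j₁).cast rfl hy.symm := by
    by_cases hx : x ∈ range j₁
    · obtain ⟨y, rfl⟩ := hx
      refine ⟨fun _ => Path.Homotopic.Quotient.map (.mk (PathConnectedSpace.somePath y₀ y)) j₁,
        fun _ y' hy' => ?_⟩
      obtain rfl := h₁.injective hy'
      exact ⟨.mk (PathConnectedSpace.somePath y₀ y'), by simp⟩
    · exact ⟨fun h => absurd h hx, fun h => absurd h hx⟩
  choose q₁ hq₁ using hq₁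
  -- Points of `Y` are reached inside `Y`; any other point is reached through `Y` to the bottom of
  -- its vertical line and then vertically.
  have hp (x : X) : ∃ p : Path.Homotopic.Quotient (j₁ y₀) x, (∀ h, p = q₁ x h) ∧
      ∀ z t (h : j₂ (z, t) = x), x ∉ range j₁ →
        p = ((q₁ (j₂ (z, 0)) ((hS z 0).2 (by simp))).trans (vert z t)).cast rfl h.symm := by
    by_cases hx : x ∈ range j₁
    · exact ⟨q₁ x hx, fun _ => rfl, fun z t h h' => absurd hx h'⟩
    · obtain ⟨⟨z, t⟩, rfl⟩ := (hcov x).resolve_left hx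
      refine ⟨(q₁ (j₂ (z, 0)) ((hS z 0).2 (by simp))).trans (vert z t),
        fun h => absurd h hx, fun z' t' h _ => ?_⟩
      obtain ⟨rfl, rfl⟩ := Prod.mk.inj (h₂.injective h)
      simp
  choose p hp₁ hp₂ using hp
  let H := (map j₁ y₀).range
  let Good {x y : X} (q : Path.Homotopic.Quotient x y) : Prop :=
    fromPath (((p x).trans q).trans (p y).symm) ∈ H
  have good_trans {x y z : X} {q : Path.Homotopic.Quotient x y} {r : Path.Homotopic.Quotient y z}
      (hq : Good q) (hr : Good r) : Good (q.trans r) := by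
    have := H.mul_mem hr hq
    rw [mul_def] at this
    simp only [Path.Homotopic.Quotient.trans_assoc] at this
    rw [← Path.Homotopic.Quotient.trans_assoc (p y).symm, Path.Homotopic.Quotient.symm_trans,
      Path.Homotopic.Quotient.refl_trans] at this
    simpa only [Good, Path.Homotopic.Quotient.trans_assoc] using this
  have good_refl (x : X) : Good (.refl x) := by
    have : fromPath (((p x).trans (.refl x)).trans (p x).symm) = 1 := by
      simp only [Path.Homotopic.Quotient.trans_refl, Path.Homotopic.Quotient.trans_symm]
      rfl
    simp only [Good, this]
    exact H.one_mem
  have good_of_trans {x y z : X} {q : Path.Homotopic.Quotient x y}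
      {r : Path.Homotopic.Quotient y z} (hq : Good q) (hqr : Good (q.trans r)) : Good r := by
    have := H.mul_mem hqr (H.inv_mem hq)
    rw [mul_def, inv_def] at this
    have e : (fromPath (((p x).trans q).trans (p y).symm)).symm.trans
        (((p x).trans (q.trans r)).trans (p z).symm) = ((p y).trans r).trans (p z).symm := by
      have e1 : ((p x).trans (q.trans r)).trans (p z).symm =
          (((p x).trans q).trans (p y).symm).trans (((p y).trans r).trans (p z).symm) := by
        simp only [Path.Homotopic.Quotient.trans_assoc]
        rw [← Path.Homotopic.Quotient.trans_assoc (p y).symm, Path.Homotopic.Quotient.symm_trans,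
          Path.Homotopic.Quotient.refl_trans]
      rw [e1, ← Path.Homotopic.Quotient.trans_assoc, Path.Homotopic.Quotient.symm_trans,
        Path.Homotopic.Quotient.refl_trans]
    have h3 : fromPath (((p y).trans r).trans (p z).symm) ∈ H := e ▸ this
    exact h3
  have good_symm {x y : X} {q : Path.Homotopic.Quotient x y} (hq : Good q) : Good q.symm :=
    good_of_trans hq (by rw [Path.Homotopic.Quotient.trans_symm]; exact good_refl x)
  have good₁ {u v : Y} (γ : Path.Homotopic.Quotient u v) : Good (γ.map j₁) := by
    obtain ⟨α, hα⟩ := hq₁ _ ⟨u, rfl⟩ u rfl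
    obtain ⟨β, hβ⟩ := hq₁ _ ⟨v, rfl⟩ v rfl
    rw [Path.Homotopic.Quotient.cast_rfl_rfl] at hα hβ
    refine ⟨fromPath ((α.trans γ).trans β.symm), ?_⟩
    rw [hp₁ _ ⟨u, rfl⟩, hp₁ _ ⟨v, rfl⟩, hα, hβ]
    induction α with | mk α =>
    induction β with | mk β =>
    induction γ with | mk γ =>
    have e : ((α.trans γ).trans β.symm).map j₁.continuous = ((α.map j₁.continuous).trans
        (γ.map j₁.continuous)).trans (β.map j₁.continuous).symm := by
      rw [Path.map_trans, Path.map_trans, Path.map_symm]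
    exact congrArg Path.Homotopic.Quotient.mk e
  have good₁' {x y : X} (q : Path x y) (hq : ∀ t, q t ∈ range j₁) :
      Good (Path.Homotopic.Quotient.mk q) := by
    choose γ hγ using hq
    have hγc : Continuous γ := by
      rw [h₁.isInducing.continuous_iff]
      exact q.continuous.congr fun t => (hγ t).symm
    obtain rfl : j₁ (γ 0) = x := by rw [hγ, q.source]
    obtain rfl : j₁ (γ 1) = y := by rw [hγ, q.target]
    have : q = Path.map ⟨⟨γ, hγc⟩, rfl, rfl⟩ j₁.continuous := by
      ext t
      exact (hγ t).symm
    rw [this]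
    exact good₁ (.mk _)
  have good_vert (z : M) (t : I) : Good (vert z t) := by
    by_cases hx : j₂ (z, t) ∈ range j₁
    · have easy {z : M} {t : I} (h : z ∈ B ∨ t = 0) : Good (vert z t) := by
        refine good₁' _ fun s => (hS z (s * t)).2 ?_
        rcases h with h | rfl
        · exact .inl h
        · exact .inr (.inl (mul_zero s))
      rcases (hS z t).1 hx with h | h | rfl
      · exact easy (.inl h)
      · exact easy (.inr h)
      -- A full vertical arc joins two points of `Y` through the product. Sliding its foot to a
      -- point `w` of `B` moves it into `Y`, since the ends of the product and the wall over `B` lie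
      -- in `Y`.
      · obtain ⟨w, hw⟩ := hB
        let γ : Path z w := PathConnectedSpace.somePath z w
        have hsq := Path.Homotopic.square ⟨fun x : I × I => j₂ (γ x.1, x.2), by fun_prop⟩
          ((γ.prod (Path.refl 0)).map j₂.continuous) ((Path.vert w 1).map j₂.continuous)
          ((Path.vert z 1).map j₂.continuous) ((γ.prod (Path.refl 1)).map j₂.continuous)
          (fun t => rfl) (by simp [Path.vert]) (by simp [Path.vert]) (fun t => rfl)
        have hbot : Good (Path.Homotopic.Quotient.mk ((γ.prod (Path.refl 0)).map j₂.continuous)) :=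
          good₁' _ fun t => (hS _ 0).2 (by simp)
        have htop : Good (Path.Homotopic.Quotient.mk ((γ.prod (Path.refl 1)).map j₂.continuous)) :=
          good₁' _ fun t => (hS _ 1).2 (by simp)
        have h := good_trans (good_trans hbot (easy (.inl hw) : Good (vert w 1))) (good_symm htop)
        rw [hsq, Path.Homotopic.Quotient.trans_assoc, Path.Homotopic.Quotient.trans_symm,
          Path.Homotopic.Quotient.trans_refl] at h
        exact h
    · have h0 : j₂ (z, 0) ∈ range j₁ := (hS z 0).2 (by simp)
      have : fromPath (((p (j₂ (z, 0))).trans (vert z t)).trans (p (j₂ (z, t))).symm) = 1 := by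
        rw [hp₂ _ z t rfl hx, hp₁ _ h0, Path.Homotopic.Quotient.cast_rfl_rfl,
          Path.Homotopic.Quotient.trans_symm]
        rfl
      simp only [Good, this]
      exact H.one_mem
  have good₂ {u v : M × I} (γ : Path u v) :
      Good (Path.Homotopic.Quotient.mk (γ.map j₂.continuous)) := by
    -- Any path in the product is pushed down vertically to the bottom, which lies in `Y`.
    have hsq := Path.Homotopic.square ⟨fun x : I × I => j₂ ((γ x.1).1, x.2 * (γ x.1).2),
      by fun_prop⟩ (((γ.map continuous_fst).prod (Path.refl 0)).map j₂.continuous)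
      ((Path.vert v.1 v.2).map j₂.continuous) ((Path.vert u.1 u.2).map j₂.continuous)
      (γ.map j₂.continuous) (by simp) (by simp [Path.vert]) (by simp [Path.vert])
      (by simp)
    have hbot : Good (Path.Homotopic.Quotient.mk
        (((γ.map continuous_fst).prod (Path.refl 0)).map j₂.continuous)) :=
      good₁' _ fun t => (hS _ 0).2 (by simp)
    refine good_of_trans (good_vert u.1 u.2) ?_
    have h := good_trans hbot (good_vert v.1 v.2)
    rw [hsq] at h
    exact h
  refine ⟨fun x => ⟨p x⟩, fun g => ?_⟩
  have htop : H = ⊤ := by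
    refine subgroup_eq_top_of_local H p fun x => ?_
    obtain ⟨N, hN, hsc⟩ := hX x
    obtain ⟨N₁, hN₁, hj₁⟩ := exists_nhds_short_path h₁ hc₁ hN
    obtain ⟨N₂, hN₂, hj₂⟩ := exists_nhds_short_path h₂ hc₂ hN
    have hshort (y : X) (hy : y ∈ N ∩ (N₁ ∩ N₂)) :
        ∃ q : Path y x, (∀ t, q t ∈ N) ∧ Good (Path.Homotopic.Quotient.mk q) := by
      rcases hcov y with ⟨u, rfl⟩ | ⟨u, rfl⟩
      · obtain ⟨v, γ, rfl, hγ⟩ := hj₁ u hy.2.1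
        exact ⟨γ.map j₁.continuous, hγ, good₁ (.mk γ)⟩
      · obtain ⟨v, γ, rfl, hγ⟩ := hj₂ u hy.2.2
        exact ⟨γ.map j₂.continuous, hγ, good₂ γ⟩
    -- The pieces are closed, so a short path may cross between them infinitely often. It is
    -- replaced by a homotopic detour through `x` with each half in a single piece.
    refine ⟨N ∩ (N₁ ∩ N₂), Filter.inter_mem hN (Filter.inter_mem hN₁ hN₂), fun y z q hq => ?_⟩
    obtain ⟨α, hαN, hα⟩ := hshort y (by simpa using hq 0)
    obtain ⟨β, hβN, hβ⟩ := hshort z (by simpa using hq 1)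
    have hαβ (t : I) : (α.trans β.symm) t ∈ N := by
      have hr : range (α.trans β.symm) ⊆ N := by
        rw [Path.trans_range, Path.symm_range, union_subset_iff]
        exact ⟨range_subset_iff.2 hαN, range_subset_iff.2 hβN⟩
      exact hr (mem_range_self t)
    rw [hsc _ _ q (α.trans β.symm) (fun t => (hq t).1) hαβ]
    exact good_trans hα (good_symm hβ)
  have hg : g ∈ H := htop ▸ Subgroup.mem_top g
  exact hg

end FundamentalGroup

/-! ### Tangle complements and meridian generators of 2-bridge knots. -/

/-- Short paths with common endpoints in an open subset of the sphere are homotopic. -/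
theorem Sphere3.exists_nhds_path_unique {O : Set Sphere3} (hO : IsOpen O) (x : O) :
    ∃ N ∈ 𝓝 x, ∀ a b (p q : Path a b), (∀ t, p t ∈ N) → (∀ t, q t ∈ N) →
      Path.Homotopic.Quotient.mk p = .mk q := by
  classical
  obtain ⟨s, ψ, hs, hψ, hsp, hψs, hsψ⟩ := Sphere3.exists_coordinates (-(x : Sphere3))
  have hx : (x : Sphere3) ≠ -(x : Sphere3) := ne_neg_of_mem_unit_sphere ℝ (x : Sphere3)
  obtain ⟨ε, hε, hsub⟩ := Metric.mem_nhds_iff.1 ((hO.preimage hs).mem_nhds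
    (show ψ x ∈ s ⁻¹' O by rw [mem_preimage, hsψ _ hx]; exact x.2))
  let f (v : Fin 3 → ℝ) : O := if h : s v ∈ O then ⟨s v, h⟩ else x
  have hf {v : Fin 3 → ℝ} (h : s v ∈ O) : (f v : Sphere3) = s v := by simp [f, h]
  have hfc : ContinuousOn f (ball (ψ x) ε) := by
    rw [Topology.IsEmbedding.subtypeVal.continuousOn_iff]
    exact hs.continuousOn.congr fun v hv => hf (hsub hv)
  let N : Set O := Subtype.val ⁻¹' ({-(x : Sphere3)}ᶜ ∩ ψ ⁻¹' ball (ψ x) ε)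
  have hN : N ∈ 𝓝 x := by
    refine continuous_subtype_val.continuousAt.preimage_mem_nhds ?_
    exact (hψ.isOpen_inter_preimage isOpen_compl_singleton isOpen_ball).mem_nhds
      ⟨hx, mem_ball_self hε⟩
  have key {a b : O} (p : Path a b) (hp : ∀ t, p t ∈ N) :
      Continuous (fun t => ψ (p t)) ∧ ∀ t, p t = f (ψ (p t)) := by
    refine ⟨hψ.comp_continuous (by fun_prop) fun t => (hp t).1, fun t => Subtype.ext ?_⟩
    rw [hf (hsub (hp t).2), hsψ _ (hp t).1]
  refine ⟨N, hN, fun a b p q hp hq => ?_⟩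
  exact Path.Homotopic.mk_eq_of_convex (convex_ball (ψ x) ε) hfc p q _ _ (key p hp).1 (key q hq).1
    (fun t => (hp t).2) (fun t => (hq t).2) (by simp) (by simp) (key p hp).2 (key q hq).2

/-- The zero section of a product with the interval is surjective on fundamental groups. -/
theorem FundamentalGroup.map_zeroSection_surjective {M : Type*} [TopologicalSpace M]
    (k : C(M, M × I)) (hk : ∀ z, k z = (z, 0)) (y : M) :
    Function.Surjective (FundamentalGroup.map k y) := by
  obtain rfl : k = ⟨fun z => (z, 0), by fun_prop⟩ := ContinuousMap.ext hk
  intro γ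
  let F : (ContinuousMap.id (M × I)).Homotopy
      ((⟨fun z => (z, 0), by fun_prop⟩ : C(M, M × I)).comp ⟨Prod.fst, continuous_fst⟩) :=
    ⟨⟨fun x => (x.2.1, σ x.1 * x.2.2), by fun_prop⟩, fun x => by simp, fun x => by simp⟩
  have h := F.map_eq_conjPath γ
  rw [map_id_apply, map_comp_apply] at h
  have e : F.evalAt (y, (0 : I)) = Path.refl (y, (0 : I)) := by
    ext t
    · rfl
    · exact congrArg Subtype.val (mul_zero (σ t))
  refine ⟨map ⟨Prod.fst, continuous_fst⟩ (y, (0 : I)) γ, Eq.trans ?_ h.symm⟩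
  refine (conjPath_refl _).symm.trans ?_
  exact congrArg (fun c => conjPath (Path.Homotopic.Quotient.mk c) _) e.symm

namespace TameKnot

variable (K : TameKnot)

/-- The radial retraction as a map on the complement of the knot. -/
noncomputable def retraction : C(↥K.coreᶜ, K.exterior) :=
  ⟨fun x => K.retr x, K.continuousOn_retr.comp_continuous continuous_subtype_val fun x => x.2⟩

/-- The inclusion of the exterior into the complement of the knot. -/
def inclusion : C(K.exterior, ↥K.coreᶜ) :=
  ⟨Set.inclusion K.exterior_subset, continuous_inclusion _⟩

theorem retraction_comp_inclusion : K.retraction.comp K.inclusion = .id _ :=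
  ContinuousMap.ext K.retr_of_mem

/-- A retraction is surjective on fundamental groups; the path `c` accounts for the change of base
point. -/
theorem exists_conjPath_retraction_surjective {x₀ : ↥K.coreᶜ}
    (e : Path.Homotopic.Quotient x₀ (K.inclusion K.basePoint)) :
    ∃ c : Path.Homotopic.Quotient K.basePoint (K.retraction x₀), Function.Surjective
      ((FundamentalGroup.conjPath c).comp (FundamentalGroup.map K.retraction x₀)) := by
  let F : (K.retraction.comp K.inclusion).Homotopy (.id _) :=
    (ContinuousMap.Homotopy.refl _).cast rfl K.retraction_comp_inclusion
  let E : Path.Homotopic.Quotient (K.retraction x₀) K.basePoint :=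
    (e.map K.retraction).trans (.mk (F.evalAt K.basePoint))
  refine ⟨E.symm, fun g => ⟨FundamentalGroup.conjPath e
    (FundamentalGroup.map K.inclusion K.basePoint g), ?_⟩⟩
  have h : FundamentalGroup.map K.retraction (K.inclusion K.basePoint)
      (FundamentalGroup.map K.inclusion K.basePoint g) =
      FundamentalGroup.conjPath (.mk (F.evalAt K.basePoint)) g := by
    rw [← FundamentalGroup.map_comp_apply, F.map_eq_conjPath, FundamentalGroup.map_id_apply]
  rw [MonoidHom.comp_apply, FundamentalGroup.map_conjPath, h]
  have h2 := FundamentalGroup.conjPath_conjPath (e.map K.retraction)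
    (.mk (F.evalAt K.basePoint)) g
  refine (congrArg (FundamentalGroup.conjPath E.symm) h2).trans ?_
  refine (FundamentalGroup.conjPath_conjPath _ _ _).trans ?_
  exact (congrArg (fun c => FundamentalGroup.conjPath c g) (Path.Homotopic.Quotient.symm_trans E)).trans
    (FundamentalGroup.conjPath_refl g)

/-- A neighbourhood of the point over `z` of the knot. -/
def coreNhd (z : Circle) : Set Sphere3 :=
  K.tube '' {p | 0 < ((p.1 : ℂ) / z).re ∧ ‖p.2‖ < 1}

theorem isOpen_coreNhd (z : Circle) : IsOpen (K.coreNhd z) := by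
  have h : Continuous fun p : Circle × ℂ => ((p.1 : ℂ) / z).re := by
    have := Circle.isEmbedding_coe.continuous
    simp only [div_eq_mul_inv]
    fun_prop
  exact K.isOpen_tube_image ((isOpen_lt continuous_const h).inter
    (isOpen_lt (by fun_prop : Continuous fun p : Circle × ℂ => ‖p.2‖) continuous_const))

/-- A map into the complement of the knot near a point of the knot can be deformed into a
meridian. -/
theorem exists_homotopy_meridianCircle {X : Type*} [TopologicalSpace X] {f : C(X, ↥K.coreᶜ)}
    {z : Circle} (hf : ∀ x, (f x : Sphere3) ∈ K.coreNhd z) :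
    ∃ d : C(X, Circle), Nonempty ((K.retraction.comp f).Homotopy ((K.meridianCircle z).comp d)) := by
  have hc : Continuous fun x => K.coord (f x) :=
    K.continuousOn_coord.comp_continuous (by fun_prop)
      fun x => image_subset_range _ _ (hf x)
  have hcoord (x : X) : 0 < (((K.coord (f x)).1 : ℂ) / z).re ∧ ‖(K.coord (f x)).2‖ < 1 ∧
      K.tube (K.coord (f x)) = f x := by
    obtain ⟨p, hp, h⟩ := hf x
    rw [← h, K.coord_tube]
    exact ⟨hp.1, hp.2, rfl⟩
  have h0 (x : X) : (K.coord (f x)).2 ≠ 0 := fun h =>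
    (f x).2 ((hcoord x).2.2 ▸ K.tube_mem_core.2 h)
  have hd : Continuous fun x => (K.coord (f x)).2.dir :=
    Complex.continuousOn_dir.comp_continuous (by fun_prop) h0
  -- The longitudinal coordinate relative to `z` stays in the right half plane, so it contracts
  -- linearly to `1` without meeting `0`.
  let g (x : I × X) : ℂ := (1 - (x.1 : ℝ) : ℝ) * (((K.coord (f x.2)).1 : ℂ) / z) + (x.1 : ℝ)
  have hg0 (x : I × X) : g x ≠ 0 := by
    intro h
    have h1 := (hcoord x.2).1
    have h2 := congrArg Complex.re h
    simp only [g, Complex.add_re, Complex.re_ofReal_mul, Complex.ofReal_re, Complex.zero_re] at h2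
    have h3 : 0 ≤ (1 - (x.1 : ℝ)) := by linarith [x.1.2.2]
    have h4 := x.1.2.1
    rcases h4.eq_or_lt with h5 | h5
    · rw [← h5] at h2
      linarith
    · nlinarith [mul_nonneg h3 h1.le]
  have hgc : Continuous g := by
    have h1 : Continuous fun x : I × X => (((K.coord (f x.2)).1 : Circle) : ℂ) :=
      Circle.isEmbedding_coe.continuous.comp (continuous_fst.comp (hc.comp continuous_snd))
    simp only [g, div_eq_mul_inv]
    fun_prop
  have hgd : Continuous fun x => (g x).dir :=
    Complex.continuousOn_dir.comp_continuous hgc hg0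
  refine ⟨⟨_, hd⟩, ⟨⟨⟨fun x => K.bdryPoint (z * (g x).dir) (K.coord (f x.2)).2.dir, ?_⟩,
    fun x => ?_, fun x => ?_⟩⟩⟩
  · exact K.continuous_bdryPoint.comp (f := fun x : I × X =>
      (z * (g x).dir, (K.coord (f x.2)).2.dir)) ((continuous_const.mul hgd).prodMk
        (hd.comp continuous_snd))
  · have e : g (0, x) = (((K.coord (f x)).1 / z : Circle) : ℂ) := by simp [g]
    have h := K.retr_tube (h0 x) (hcoord x).2.1.le
    rw [(hcoord x).2.2] at h
    simp only [e, Complex.dir_circle]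
    rw [mul_div_cancel]
    exact h.symm
  · have e : g (1, x) = ((1 : Circle) : ℂ) := by simp [g]
    simp only [e, Complex.dir_circle, mul_one]
    rfl

end TameKnot

/-- The product of a punctured disc with the interval, as a subset of the cylinder. -/
def puncturedDisc.toCylinder {Q : Finset ℂ} (p : puncturedDisc Q × I) : Cylinder :=
  (⟨p.1, mem_closedBall_zero_iff.2 p.1.2.1⟩, p.2)

theorem puncturedDisc.isEmbedding_toCylinder (Q : Finset ℂ) :
    IsEmbedding (puncturedDisc.toCylinder (Q := Q)) := by
  have h : IsEmbedding fun z : puncturedDisc Q =>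
      (⟨z, mem_closedBall_zero_iff.2 z.2.1⟩ : closedBall (0 : ℂ) 1) :=
    .of_comp (by fun_prop) continuous_subtype_val IsEmbedding.subtypeVal
  exact h.prodMap .id

/-- Small circles around a puncture. -/
def puncturedDisc.circle {Q : Finset ℂ} (q : ℂ) (r : ℝ)
    (h : ∀ u : Circle, q + r * (u : ℂ) ∈ puncturedDisc Q) : C(Circle, puncturedDisc Q) :=
  ⟨fun u => ⟨q + r * u, h u⟩, Continuous.subtype_mk
    (continuous_const.add (continuous_const.mul Circle.isEmbedding_coe.continuous)) _⟩

theorem puncturedDisc.exists_circle {Q : Finset ℂ} {q : ℂ} (hq : ‖q‖ < 1) : ∃ r₀ > (0 : ℝ),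
    ∀ r, 0 < r → r < r₀ → ∀ u : Circle, q + r * (u : ℂ) ∈ puncturedDisc Q := by
  have h1 : ball (0 : ℂ) 1 ∩ ((Q.erase q : Finset ℂ) : Set ℂ)ᶜ ∈ 𝓝 q :=
    (isOpen_ball.inter (Finset.finite_toSet _).isClosed.isOpen_compl).mem_nhds
      ⟨by simpa using hq, by simp⟩
  obtain ⟨ε, hε, hsub⟩ := Metric.mem_nhds_iff.1 h1
  refine ⟨ε, hε, fun r hr hrε u => ?_⟩
  have hn : ‖(r : ℂ) * u‖ = r := by
    rw [norm_mul, Circle.norm_coe, mul_one, Complex.norm_real, Real.norm_eq_abs, abs_of_pos hr]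
  have h2 := hsub (show q + r * (u : ℂ) ∈ ball q ε by
    rw [mem_ball_iff_norm, add_sub_cancel_left, hn]; exact hrε)
  refine ⟨(mem_ball_zero_iff.1 h2.1).le, fun h3 => h2.2 ?_⟩
  refine Finset.mem_erase.2 ⟨fun h4 => ?_, h3⟩
  rw [add_eq_left] at h4
  rw [h4, norm_zero] at hn
  exact hr.ne hn

namespace TameKnot

variable (K : TameKnot)

/-- The complement of a trivial tangle in the ball is a punctured disc times an interval. -/
theorem exists_tangle_complement {B S : Set Sphere3} {n : ℕ} (h : IsTrivialTangle B S K.core n) :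
    ∃ Q : Finset ℂ, Q.card = n ∧ (∀ q ∈ Q, ‖q‖ < 1) ∧ ∃ j : C(puncturedDisc Q × I, ↥K.coreᶜ),
      IsEmbedding j ∧ IsClosed (range j) ∧ (∀ x, x ∈ range j ↔ (x : Sphere3) ∈ B) ∧
      (∀ p, (j p : Sphere3) ∈ S ↔ ‖(p.1 : ℂ)‖ = 1 ∨ p.2 = 0 ∨ p.2 = 1) ∧
      ∀ q ∈ Q, ∃ z, ∃ r₀ > (0 : ℝ), ∀ w : puncturedDisc Q, dist (w : ℂ) q < r₀ →
        (j (w, 0) : Sphere3) ∈ K.coreNhd z := by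
  obtain ⟨e, he, hB, hS, Q, hQn, hQ, hT⟩ := h
  have hmem (p : puncturedDisc Q × I) : e (puncturedDisc.toCylinder p) ∈ K.coreᶜ :=
    fun h => p.1.2.2 ((hT _).1 h)
  have hcyl := puncturedDisc.isEmbedding_toCylinder Q
  have hrange (x : ↥K.coreᶜ) : x ∈ range (fun p => (⟨_, hmem p⟩ : ↥K.coreᶜ)) ↔
      (x : Sphere3) ∈ B := by
    rw [← hB]
    constructor
    · rintro ⟨p, rfl⟩
      exact mem_range_self _
    · rintro ⟨p, hp⟩
      have hpQ : (p.1 : ℂ) ∉ Q := fun h => x.2 (hp ▸ (hT p).2 h)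
      exact ⟨(⟨p.1, mem_closedBall_zero_iff.1 p.1.2, hpQ⟩, p.2), Subtype.ext hp⟩
  refine ⟨Q, hQn, hQ, ⟨fun p => ⟨_, hmem p⟩, ?_⟩, ?_, ?_, hrange, fun p => ?_, fun q hq => ?_⟩
  · exact (he.continuous.comp hcyl.continuous).subtype_mk _
  · exact .of_comp ((he.continuous.comp hcyl.continuous).subtype_mk _) continuous_subtype_val
      (he.comp hcyl)
  · have hc : IsClosed B := hB ▸ (isCompact_range he.continuous).isClosed
    have := hc.preimage (continuous_subtype_val : Continuous (Subtype.val : ↥K.coreᶜ → Sphere3))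
    convert this using 1
    exact Set.ext hrange
  · change e _ ∈ S ↔ _
    rw [← hS, he.injective.mem_set_image]
    rfl
  · have hq1 : q ∈ closedBall (0 : ℂ) 1 := mem_closedBall_zero_iff.2 (hQ q hq).le
    obtain ⟨⟨z, w⟩, hw, hz⟩ : e (⟨q, hq1⟩, 0) ∈ K.core := (hT _).2 hq
    obtain rfl : w = 0 := hw
    have hN : e (⟨q, hq1⟩, 0) ∈ K.coreNhd z :=
      ⟨(z, 0), by simp, hz⟩
    have hc : Continuous fun w : closedBall (0 : ℂ) 1 => e (w, 0) :=
      he.continuous.comp (by fun_prop)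
    obtain ⟨r₀, hr₀, hsub⟩ := Metric.mem_nhds_iff.1
      (((K.isOpen_coreNhd z).preimage hc).mem_nhds hN)
    exact ⟨z, r₀, hr₀, fun w hw => hsub (show (⟨w, _⟩ : closedBall (0 : ℂ) 1) ∈ _ from hw)⟩

/-- In the exterior, a small loop around a strand is a power of a meridian. -/
theorem exists_isMeridian_zpowers {M : Type*} [TopologicalSpace M] {f : C(M, ↥K.coreᶜ)}
    {J : C(Circle, M)} {z : Circle} (hJ : ∀ u, (f (J u) : Sphere3) ∈ K.coreNhd z) {y : M}
    (c : Path.Homotopic.Quotient y (J 1))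
    (e : Path.Homotopic.Quotient K.basePoint (K.retraction (f y)))
    (γ : FundamentalGroup Circle 1) : ∃ m, K.IsMeridian m ∧
    FundamentalGroup.conjPath e (FundamentalGroup.map K.retraction (f y)
      (FundamentalGroup.map f y (FundamentalGroup.conjPath c (FundamentalGroup.map J 1 γ)))) ∈
        Subgroup.zpowers m := by
  obtain ⟨d, ⟨F⟩⟩ := K.exists_homotopy_meridianCircle (f := f.comp J) hJ
  obtain ⟨c', hc'⟩ := FundamentalGroup.exists_conjPath_zpowers F 1
  -- The degree of the small loop on the meridian is not computed: being a power of a meridian is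
  -- enough for generation.
  refine ⟨FundamentalGroup.conjPath e (FundamentalGroup.conjPath
    ((c.map f).map K.retraction) (FundamentalGroup.conjPath c' (K.mer z))), ?_, ?_⟩
  · refine (K.isMeridian_iff _).2 ⟨z, e.trans (((c.map f).map K.retraction).trans c'), .inl ?_⟩
    exact (congrArg _ (FundamentalGroup.conjPath_conjPath _ _ _)).trans
      (FundamentalGroup.conjPath_conjPath _ _ _)
  · obtain ⟨n, hn⟩ := hc' γ
    refine ⟨n, ?_⟩
    simp only
    rw [← map_zpow, ← map_zpow, FundamentalGroup.map_conjPath, FundamentalGroup.map_conjPath]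
    refine congrArg _ (congrArg _ (Eq.trans hn ?_))
    exact (FundamentalGroup.map_comp_apply K.retraction (f.comp J) 1 γ).trans
      (congrArg _ (FundamentalGroup.map_comp_apply f J 1 γ))

/-- The group of a knot with a 2-bridge presentation is generated by two meridians. -/
theorem HasBridgePresentation.exists_closure_eq_top {K : TameKnot} (h : K.HasBridgePresentation 2) :
    ∃ m₁ m₂, K.IsMeridian m₁ ∧ K.IsMeridian m₂ ∧ Subgroup.closure {m₁, m₂} = ⊤ := by
  obtain ⟨B₁, B₂, hcov, h₁, h₂⟩ := h
  have hpc {Q : Finset ℂ} (hn : Q.card = 2) (hQ : ∀ q ∈ Q, ‖q‖ < 1) :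
      ∃ q₁ ∈ Q, ∃ q₂ ∈ Q, ∃ r₀ > (0 : ℝ), ∀ r, 0 < r → r < r₀ →
        ∃ J₁ J₂ : C(Circle, puncturedDisc Q), (∀ u, (J₁ u : ℂ) = q₁ + r * u) ∧
          (∀ u, (J₂ u : ℂ) = q₂ + r * u) ∧ ∃ (y : puncturedDisc Q)
          (c₁ : Path.Homotopic.Quotient y (J₁ 1)) (c₂ : Path.Homotopic.Quotient y (J₂ 1)),
          (∀ x, Joined y x) ∧ Subgroup.closure {FundamentalGroup.conjPath c₁
            (FundamentalGroup.map J₁ 1 FundamentalGroup.circleGen), FundamentalGroup.conjPath c₂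
            (FundamentalGroup.map J₂ 1 FundamentalGroup.circleGen)} = ⊤ := by
    obtain ⟨q₁, q₂, hne, rfl⟩ := Finset.card_eq_two.1 hn
    have h₁ : ‖q₁‖ < 1 := hQ _ (by simp)
    have h₂ : ‖q₂‖ < 1 := hQ _ (by simp)
    obtain ⟨a, ha, Ha⟩ := puncturedDisc_fundamentalGroup h₁ h₂ hne
    obtain ⟨b, hb, Hb⟩ := puncturedDisc.exists_circle (Q := {q₁, q₂}) h₁
    obtain ⟨c, hc, Hc⟩ := puncturedDisc.exists_circle (Q := {q₁, q₂}) h₂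
    refine ⟨q₁, by simp, q₂, by simp, min a (min b c), lt_min ha (lt_min hb hc),
      fun r hr h => ?_⟩
    simp only [lt_min_iff] at h
    exact ⟨puncturedDisc.circle q₁ r (Hb r hr h.2.1), puncturedDisc.circle q₂ r (Hc r hr h.2.2),
      fun _ => rfl, fun _ => rfl,
      Ha r hr h.1 _ _ (fun _ => rfl) fun _ => rfl⟩
  have hconn {Q : Finset ℂ} (hn : Q.card = 2) (hQ : ∀ q ∈ Q, ‖q‖ < 1) :
      PathConnectedSpace (puncturedDisc Q) := by
    obtain ⟨q₁, -, q₂, -, r₀, hr₀, H⟩ := hpc hn hQ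
    obtain ⟨-, -, -, -, y, -, -, hy, -⟩ := H (r₀ / 2) (by positivity) (by linarith)
    exact ⟨⟨y⟩, fun x x' => (hy x).symm.trans (hy x')⟩
  obtain ⟨Q₁, hn₁, hQ₁, j₁, he₁, hc₁, hr₁, hS₁, ht₁⟩ := K.exists_tangle_complement h₁
  obtain ⟨Q₂, hn₂, hQ₂, j₂, he₂, hc₂, hr₂, hS₂, -⟩ := K.exists_tangle_complement h₂
  have := hconn hn₁ hQ₁
  have := hconn hn₂ hQ₂
  have : PathConnectedSpace I := isPathConnected_iff_pathConnectedSpace.1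
    ((convex_Icc (0 : ℝ) 1).isPathConnected ⟨0, by simp⟩)
  obtain ⟨q₁, hq₁, q₂, hq₂, r₀, hr₀, H⟩ := hpc hn₁ hQ₁
  obtain ⟨z₁, a, ha, hz₁⟩ := ht₁ q₁ hq₁
  obtain ⟨z₂, b, hb, hz₂⟩ := ht₁ q₂ hq₂
  -- The circles must be small enough both to generate and to lie in the chosen neighbourhoods of
  -- the knot.
  obtain ⟨r, hr, hr'⟩ := exists_between (lt_min hr₀ (lt_min ha hb))
  simp only [lt_min_iff] at hr'
  obtain ⟨J₁, J₂, hJ₁, hJ₂, y, c₁, c₂, -, htop⟩ := H r hr hr'.1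
  have hdist (q : ℂ) (u : Circle) : dist (q + r * (u : ℂ)) q = r := by
    rw [dist_eq_norm, add_sub_cancel_left, norm_mul, Circle.norm_coe, mul_one, Complex.norm_real,
      Real.norm_eq_abs, abs_of_pos hr]
  let k : C(puncturedDisc Q₁, puncturedDisc Q₁ × I) := ⟨fun z => (z, 0), by fun_prop⟩
  -- The side wall of the second cylinder lies in the common boundary sphere, hence in the first
  -- ball.
  have hB : {z : puncturedDisc Q₂ | ‖(z : ℂ)‖ = 1}.Nonempty :=
    ⟨⟨1, by simp, fun h => by simpa using hQ₂ _ h⟩, by simp⟩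
  obtain ⟨hpath, hsurj⟩ := FundamentalGroup.map_surjective_of_union_prod he₁ he₂ hc₁ hc₂
    (fun x => by
      rw [hr₁, hr₂]
      exact (hcov ▸ mem_univ (x : Sphere3) : (x : Sphere3) ∈ B₁ ∪ B₂))
    hB (fun z t => by
      rw [hr₁]
      refine Iff.trans ⟨fun h => ⟨h, (hr₂ _).1 (mem_range_self _)⟩, fun h => h.1⟩ (hS₂ (z, t)))
    (Sphere3.exists_nhds_path_unique K.isOpen_compl_core) (k y)
  obtain ⟨e⟩ := hpath (K.inclusion K.basePoint)
  obtain ⟨c, hc⟩ := K.exists_conjPath_retraction_surjective e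
  obtain ⟨m₁, hm₁, h₁⟩ := K.exists_isMeridian_zpowers (f := j₁.comp k) (J := J₁) (z := z₁)
    (fun u => hz₁ _ (by rw [hJ₁, hdist]; exact hr'.2.1)) c₁ c FundamentalGroup.circleGen
  obtain ⟨m₂, hm₂, h₂⟩ := K.exists_isMeridian_zpowers (f := j₁.comp k) (J := J₂) (z := z₂)
    (fun u => hz₂ _ (by rw [hJ₂, hdist]; exact hr'.2.2)) c₂ c FundamentalGroup.circleGen
  -- Bottom disc of the first cylinder, then knot complement, then exterior: each stage is onto, and
  -- the two generating circles go to powers of `m₁` and `m₂`.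
  let Ψ : FundamentalGroup (puncturedDisc Q₁) y →* K.Group :=
    ((FundamentalGroup.conjPath c).comp (FundamentalGroup.map K.retraction (j₁ (k y)))).comp
      (FundamentalGroup.map (j₁.comp k) y)
  have hΨ : Function.Surjective Ψ := by
    intro g
    obtain ⟨g, rfl⟩ := hc g
    obtain ⟨g, rfl⟩ := hsurj g
    obtain ⟨g, rfl⟩ := FundamentalGroup.map_zeroSection_surjective k (fun _ => rfl) y g
    exact ⟨g, congrArg ((FundamentalGroup.conjPath c).comp
      (FundamentalGroup.map K.retraction (j₁ (k y)))) (FundamentalGroup.map_comp_apply j₁ k y g)⟩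
  refine ⟨m₁, m₂, hm₁, hm₂, ?_⟩
  rw [eq_top_iff, ← MonoidHom.range_eq_top.2 hΨ, MonoidHom.range_eq_map, ← htop,
    MonoidHom.map_closure, Subgroup.closure_le, image_pair]
  rintro _ (rfl | rfl)
  · exact (Subgroup.zpowers_le.2 (Subgroup.subset_closure (by simp))) h₁
  · exact (Subgroup.zpowers_le.2 (Subgroup.subset_closure (by simp))) h₂

/-- The infimum is over natural numbers: a presentation with fewer than three strings exists, and
none has fewer than two. -/
theorem IsTwoBridge.hasBridgePresentation {K : TameKnot} (h : K.IsTwoBridge) :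
    K.HasBridgePresentation 2 := by
  have hlt : K.bridgeNumber < 3 := by
    rw [show K.bridgeNumber = 2 from h]
    decide
  simp only [bridgeNumber, iInf_lt_iff] at hlt
  obtain ⟨n, hn, hlt⟩ := hlt
  have hle : K.bridgeNumber ≤ n := iInf₂_le n hn
  rw [show K.bridgeNumber = 2 from h] at hle
  obtain rfl : n = 2 := by
    have h1 : 2 ≤ n := by exact_mod_cast hle
    have h2 : n < 3 := by exact_mod_cast hlt
    omega
  exact hn

/-- Every epimorphism onto the group of a 2-bridge knot induces an epimorphism of
π-orbifold groups. -/
theorem IsTwoBridge.inducesOrbEpi {K₁ K₂ : TameKnot} (h : K₂.IsTwoBridge)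
    {φ : K₁.Group →* K₂.Group} (hφ : Function.Surjective φ) : InducesOrbEpi φ := by
  obtain ⟨m₁, m₂, h₁, h₂, htop⟩ := h.hasBridgePresentation.exists_closure_eq_top
  exact inducesOrbEpi_of_mem_closure hφ K₁.isMeridian_mer₀ h₁ h₂ (htop ▸ Subgroup.mem_top _)

end TameKnot

theorem mainTheorem12 :
    (∀ (K₁ K₂ : TameKnot) (φ : K₁.Group →* K₂.Group), Function.Surjective φ →
      ∀ μ : K₁.Group, K₁.IsMeridian μ → K₂.meridionalComplexity (φ μ) ≤ 2 →
        TameKnot.InducesOrbEpi φ) ∧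
    (∀ K₁ K₂ : TameKnot, TameKnot.KDominates 2 K₁ K₂ → TameKnot.PiDominates K₁ K₂) ∧
    (∀ K₁ K₂ : TameKnot, K₂.IsTwoBridge →
      (∀ φ : K₁.Group →* K₂.Group, Function.Surjective φ → TameKnot.InducesOrbEpi φ) ∧
      (TameKnot.Dominates K₁ K₂ → TameKnot.PiDominates K₁ K₂)) := by
  have h1 : ∀ (K₁ K₂ : TameKnot) (φ : K₁.Group →* K₂.Group), Function.Surjective φ →
      ∀ μ : K₁.Group, K₁.IsMeridian μ → K₂.meridionalComplexity (φ μ) ≤ 2 →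
        TameKnot.InducesOrbEpi φ := fun K₁ K₂ φ hφ μ hμ h =>
    TameKnot.inducesOrbEpi_of_complexity_le_two hφ hμ h
  have h3 : ∀ K₁ K₂ : TameKnot, K₂.IsTwoBridge →
      ∀ φ : K₁.Group →* K₂.Group, Function.Surjective φ → TameKnot.InducesOrbEpi φ := fun K₁ K₂ h φ hφ => h.inducesOrbEpi hφ
  refine ⟨h1, ?_, fun K₁ K₂ h => ⟨h3 K₁ K₂ h, ?_⟩⟩
  · rintro K₁ K₂ ⟨φ, hφ, μ, hμ, h⟩
    obtain ⟨ψ, hψ, -⟩ := h1 K₁ K₂ φ hφ μ hμ h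
    exact ⟨ψ, hψ⟩
  · rintro ⟨φ, hφ⟩
    obtain ⟨ψ, hψ, -⟩ := h3 K₁ K₂ h φ hφ
    exact ⟨ψ, hψ⟩
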